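/- Let $m$ be an odd natural number, let $n\ge 1$, and let $\nu$ be a partition of $n-1$ with at most $m$ parts. Let $\phi^{(m^n)}$ be the permutation character of the symmetric group $S_{mn}$ acting on the set partitions of a set of size $mn$ into $n$ sets each of size $m$, and for a partition $\lambda$ of $mn$ let $\chi^\lambda$ be the irreducible character of $S_{mn}$ afforded by the rational Specht module $S^\lambda$. Let $(m^n)\star\nu$ be the partition of $mn$ obtained from $(m^n)$ by deleting, for each $i$ with $\nu_i>0$, the lowest $\nu_i$ boxes from column $m+1-i$ of its Young diagram, and then adding $\nu_i$ boxes to row $i$. Then $$\left\langle \phi^{(m^n)},\ \chi^{(m^n)\star\nu}\right\rangle = 1 .$$ Moreover, $\left\langle \phi^{(m^n)},\chi^\mu\right\rangle = 0$ for every partition $\mu$ of $mn$ with $\mu\lhd (m^n)\star\nu$, that is, for every $\mu\ne (m^n)\star\nu$ such that $\sum_{i=1}^{j}\mu_i\le\sum_{i=1}^{j}((m^n)\star\nu)_i$ for all $j\ge 1$. -/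

import Mathlib

namespace Foulkes

open Finset

/-! ### Partitions and the dominance order -/

/-- The partitions of `r`, given by their Young diagrams (cells `(row, column)`, counted from `0`).
The part `λ_{i+1}` of `λ` is the row length `λ.1.rowLen i` (which is `0` for large `i`). -/
abbrev PartitionOf (r : ℕ) : Type := {l : YoungDiagram // l.card = r}

/-- The number of (non-zero) parts of a partition: the length of the first column. -/
def numParts {r : ℕ} (l : PartitionOf r) : ℕ := l.1.colLen 0

/-- `Dominated μ l` : the partition `l` dominates the partition `μ`, i.e. every partial sum
`μ_1 + ⋯ + μ_j` is at most `l_1 + ⋯ + l_j`. -/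
def Dominated {r : ℕ} (μ l : PartitionOf r) : Prop :=
  ∀ j : ℕ, ∑ i ∈ range j, μ.1.rowLen i ≤ ∑ i ∈ range j, l.1.rowLen i

/-- `StrictlyDominated μ l` : `l` dominates `μ`, and `μ ≠ l`. -/
def StrictlyDominated {r : ℕ} (μ l : PartitionOf r) : Prop :=
  Dominated μ l ∧ μ ≠ l

/-! ### The partition `(m^n) ⋆ ν` -/

theorem rowLen_add_colLen_le (ν : YoungDiagram) : ν.rowLen 0 + ν.colLen 0 ≤ ν.card + 1 := by
  have h : (ν.row 0 ∪ ν.col 0).card ≤ ν.card := by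
    apply card_le_card
    intro c hc
    rcases mem_union.1 hc with h | h
    · exact (YoungDiagram.mem_row_iff.1 h).1
    · exact (YoungDiagram.mem_col_iff.1 h).1
  have h2 : (ν.row 0 ∩ ν.col 0).card ≤ 1 := by
    rw [card_le_one]
    intro a ha b hb
    simp only [mem_inter, YoungDiagram.mem_row_iff, YoungDiagram.mem_col_iff] at ha hb
    exact Prod.ext (ha.1.2.trans hb.1.2.symm) (ha.2.2.trans hb.2.2.symm)
  have h3 := card_union_add_card_inter (ν.row 0) (ν.col 0)
  rw [YoungDiagram.rowLen_eq_card, YoungDiagram.colLen_eq_card]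
  omega

/-- The boxes deleted from the `n × m` rectangle `(m^n)`: the box `j` of row `i` of `ν` (counted
from `0`) deletes the box of column `m - 1 - i` that is `j` steps above its bottom box, so that
the lowest `ν_{i+1}` boxes of the column with (one-based) number `m + 1 - (i + 1)` disappear. -/
def starRemoved (m n : ℕ) (ν : YoungDiagram) : Finset (ℕ × ℕ) :=
  ν.cells.image fun c => (n - 1 - c.2, m - 1 - c.1)

/-- The boxes added to the rectangle `(m^n)`: `ν_{i+1}` boxes at the end of row `i + 1`. -/
def starAdded (m : ℕ) (ν : YoungDiagram) : Finset (ℕ × ℕ) :=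
  ν.cells.image fun c => (c.1, m + c.2)

/-- The set of boxes of `(m^n) ⋆ ν`. -/
def starCells (m n : ℕ) (ν : YoungDiagram) : Finset (ℕ × ℕ) :=
  ((range n ×ˢ range m) \ starRemoved m n ν) ∪ starAdded m ν

theorem bounds_of_mem {m n : ℕ} (hn : 0 < n) (ν : PartitionOf (n - 1)) (hν : numParts ν ≤ m)
    {i j : ℕ} (h : (i, j) ∈ ν.1) : i < m ∧ j < n ∧ i < ν.1.colLen 0 ∧ j < ν.1.rowLen 0 ∧
      ν.1.rowLen 0 + ν.1.colLen 0 ≤ n := by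
  have h1 : i < ν.1.colLen 0 :=
    (YoungDiagram.mem_iff_lt_colLen.1 h).trans_le (ν.1.colLen_anti 0 j (Nat.zero_le _))
  have h2 : j < ν.1.rowLen 0 :=
    (YoungDiagram.mem_iff_lt_rowLen.1 h).trans_le (ν.1.rowLen_anti 0 i (Nat.zero_le _))
  have h3 := rowLen_add_colLen_le ν.1
  have h4 := ν.2
  simp only [numParts] at hν
  omega

theorem isLowerSet_starCells {m n : ℕ} (hn : 0 < n) (ν : PartitionOf (n - 1))
    (hν : numParts ν ≤ m) : IsLowerSet (starCells m n ν.1 : Set (ℕ × ℕ)) := by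
  have key : ∀ r c, r < n → c < m →
      ((r, c) ∈ starRemoved m n ν.1 ↔ (m - 1 - c, n - 1 - r) ∈ ν.1) := by
    intro r c hr hc
    simp only [starRemoved, mem_image, YoungDiagram.mem_cells, Prod.mk.injEq, Prod.exists]
    constructor
    · rintro ⟨i, j, hij, h1, h2⟩
      obtain ⟨b1, b2, -⟩ := bounds_of_mem hn ν hν hij
      convert hij using 2 <;> omega
    · intro h
      exact ⟨_, _, h, by omega, by omega⟩
  rintro ⟨r, c⟩ ⟨r', c'⟩ ⟨hr, hc⟩ h
  simp only at hr hc
  simp only [starCells, coe_union, Set.mem_union, mem_coe, mem_sdiff, mem_product, mem_range] at h ⊢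
  rcases h with ⟨⟨h1, h2⟩, h3⟩ | h
  · left
    refine ⟨⟨by omega, by omega⟩, ?_⟩
    rw [key _ _ (by omega) (by omega)]
    rw [key _ _ h1 h2] at h3
    exact fun h4 => h3 (ν.1.up_left_mem (by omega) (by omega) h4)
  · simp only [starAdded, mem_image, YoungDiagram.mem_cells, Prod.mk.injEq, Prod.exists] at h ⊢
    obtain ⟨i, j, hij, rfl, rfl⟩ := h
    obtain ⟨b1, b2, b3, b4, b5⟩ := bounds_of_mem hn ν hν hij
    rcases lt_or_ge c' m with hcm | hcm
    · left
      refine ⟨⟨by omega, hcm⟩, ?_⟩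
      rw [key _ _ (by omega) hcm]
      intro h4
      obtain ⟨d1, d2, d3, d4, d5⟩ := bounds_of_mem hn ν hν h4
      omega
    · right
      exact ⟨r', c' - m, ν.1.up_left_mem hr (by omega) hij, rfl, by omega⟩

theorem card_starCells {m n : ℕ} (hn : 0 < n) (ν : PartitionOf (n - 1))
    (hν : numParts ν ≤ m) : (starCells m n ν.1).card = m * n := by
  have hsub : starRemoved m n ν.1 ⊆ range n ×ˢ range m := by
    rintro ⟨r, c⟩ h
    simp only [starRemoved, mem_image, YoungDiagram.mem_cells, Prod.mk.injEq, Prod.exists] at h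
    obtain ⟨i, j, hij, rfl, rfl⟩ := h
    obtain ⟨b1, b2, -⟩ := bounds_of_mem hn ν hν hij
    simp only [mem_product, mem_range]
    omega
  have hr : (starRemoved m n ν.1).card = n - 1 := by
    rw [starRemoved, card_image_of_injOn]
    · exact ν.2
    rintro ⟨i, j⟩ hij ⟨i', j'⟩ hij' h
    obtain ⟨b1, b2, -⟩ := bounds_of_mem hn ν hν (by simpa using hij)
    obtain ⟨d1, d2, -⟩ := bounds_of_mem hn ν hν (by simpa using hij')
    simp only [Prod.mk.injEq] at h ⊢
    omega
  have ha : (starAdded m ν.1).card = n - 1 := by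
    rw [starAdded, card_image_of_injOn]
    · exact ν.2
    rintro ⟨i, j⟩ - ⟨i', j'⟩ - h
    simp only [Prod.mk.injEq] at h ⊢
    omega
  have hd : Disjoint ((range n ×ˢ range m) \ starRemoved m n ν.1) (starAdded m ν.1) := by
    rw [disjoint_left]
    rintro ⟨r, c⟩ h1 h2
    simp only [starAdded, mem_image, YoungDiagram.mem_cells, Prod.mk.injEq, Prod.exists] at h2
    obtain ⟨i, j, hij, rfl, rfl⟩ := h2
    simp only [mem_sdiff, mem_product, mem_range] at h1
    omega
  rw [starCells, card_union_of_disjoint hd, card_sdiff_of_subset hsub, hr, ha, card_product,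
    card_range, card_range, Nat.mul_comm m n]
  have := card_le_card hsub
  rw [hr, card_product, card_range, card_range] at this
  omega

/-- The partition `(m^n) ⋆ ν` of `mn`, for a partition `ν` of `n - 1` with at most `m` parts: delete
`ν_i` boxes from (the bottom of) column `m + 1 - i` of `(m^n)` and add `ν_i` boxes to row `i`. -/
def star {m n : ℕ} (hn : 0 < n) (ν : PartitionOf (n - 1)) (hν : numParts ν ≤ m) :
    PartitionOf (m * n) :=
  ⟨⟨starCells m n ν.1, isLowerSet_starCells hn ν hν⟩, card_starCells hn ν hν⟩

/-! ### Specht modules -/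

/-- A `λ`-tableau: a bijective filling of the boxes of `λ` with the elements of `Fin r`. -/
def Tableau {r : ℕ} (l : PartitionOf r) : Type := {c // c ∈ l.1.cells} ≃ Fin r

/-- The action of `S_r` on tableaux by permuting the entries. -/
instance tableauAction {r : ℕ} (l : PartitionOf r) :
    MulAction (Equiv.Perm (Fin r)) (Tableau l) where
  smul σ t := (Equiv.trans t σ : {c // c ∈ l.1.cells} ≃ Fin r)
  one_smul _ := rfl
  mul_smul _ _ _ := rfl

/-- The row of the tableau `t` which contains the entry `x`. -/
def Tableau.rowOf {r : ℕ} {l : PartitionOf r} (t : Tableau l) (x : Fin r) : ℕ :=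
  (Equiv.symm t x).1.1

/-- The column of the tableau `t` which contains the entry `x`. -/
def Tableau.colOf {r : ℕ} {l : PartitionOf r} (t : Tableau l) (x : Fin r) : ℕ :=
  (Equiv.symm t x).1.2

theorem Tableau.rowOf_smul {r : ℕ} {l : PartitionOf r} (σ : Equiv.Perm (Fin r)) (t : Tableau l)
    (x : Fin r) : (σ • t).rowOf x = t.rowOf (σ⁻¹ x) := rfl

theorem Tableau.colOf_smul {r : ℕ} {l : PartitionOf r} (σ : Equiv.Perm (Fin r)) (t : Tableau l)
    (x : Fin r) : (σ • t).colOf x = t.colOf (σ⁻¹ x) := rfl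

/-- Two tableaux are row equivalent if each entry lies in the same row of both, i.e. if
they agree up to the order of the entries within the rows. -/
def rowSetoid {r : ℕ} (l : PartitionOf r) : Setoid (Tableau l) where
  r t s := ∀ x, t.rowOf x = s.rowOf x
  iseqv := ⟨fun _ _ => rfl, fun h x => (h x).symm, fun h h' x => (h x).trans (h' x)⟩

/-- A `λ`-tabloid: a `λ`-tableau up to the order of the entries within the rows. -/
def Tabloid {r : ℕ} (l : PartitionOf r) : Type := Quotient (rowSetoid l)

/-- The tabloid of a tableau. -/
def Tableau.tabloid {r : ℕ} {l : PartitionOf r} (t : Tableau l) : Tabloid l :=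
  Quotient.mk (rowSetoid l) t

/-- The action of `S_r` on tabloids, `σ • {t} = {σ • t}`. -/
instance tabloidAction {r : ℕ} (l : PartitionOf r) :
    MulAction (Equiv.Perm (Fin r)) (Tabloid l) where
  smul σ := Quotient.map (σ • ·) fun t s h x => by
    rw [Tableau.rowOf_smul, Tableau.rowOf_smul]
    exact h _
  one_smul a := by
    induction a using Quotient.inductionOn with
    | h t => rfl
  mul_smul _ _ a := by
    induction a using Quotient.inductionOn with
    | h t => rfl

theorem Tableau.tabloid_smul {r : ℕ} {l : PartitionOf r} (σ : Equiv.Perm (Fin r)) (t : Tableau l) :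
    (σ • t).tabloid = σ • t.tabloid := rfl

/-- The Young permutation module `M^λ` of `S_r` over `ℚ`, with basis the set of `λ`-tabloids. -/
noncomputable def youngRep {r : ℕ} (l : PartitionOf r) :
    Representation ℚ (Equiv.Perm (Fin r)) (MonoidAlgebra ℚ (Tabloid l)) :=
  Representation.ofMulAction ℚ (Equiv.Perm (Fin r)) (Tabloid l)

open Classical in
/-- The column stabilizer `C(t)`: the permutations which fix setwise each column of `t`. -/
noncomputable def colStabilizer {r : ℕ} {l : PartitionOf r} (t : Tableau l) :
    Finset (Equiv.Perm (Fin r)) :=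
  univ.filter fun σ => ∀ x, t.colOf (σ x) = t.colOf x

theorem mem_colStabilizer {r : ℕ} {l : PartitionOf r} (t : Tableau l) (σ : Equiv.Perm (Fin r)) :
    σ ∈ colStabilizer t ↔ ∀ x, t.colOf (σ x) = t.colOf x := by
  classical
  simp [colStabilizer]

/-- The polytabloid `e_t`, the sum of `sgn(τ) τ{t}` over the `τ` in the column stabilizer of `t`. -/
noncomputable def polytabloid {r : ℕ} {l : PartitionOf r} (t : Tableau l) :
    MonoidAlgebra ℚ (Tabloid l) :=
  ∑ τ ∈ colStabilizer t, MonoidAlgebra.single (τ • t.tabloid) ((Equiv.Perm.sign τ : ℤ) : ℚ)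

theorem youngRep_polytabloid {r : ℕ} {l : PartitionOf r} (σ : Equiv.Perm (Fin r)) (t : Tableau l) :
    youngRep l σ (polytabloid t) = polytabloid (σ • t) := by
  unfold polytabloid youngRep
  rw [map_sum]
  simp only [Representation.ofMulAction_single]
  refine sum_bij' (fun τ _ => σ * τ * σ⁻¹) (fun τ _ => σ⁻¹ * τ * σ) ?_ ?_ ?_ ?_ ?_
  · intro τ hτ
    rw [mem_colStabilizer] at hτ ⊢
    intro x
    simpa [Tableau.colOf_smul] using hτ (σ⁻¹ x)
  · intro τ hτ
    rw [mem_colStabilizer] at hτ ⊢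
    intro x
    simpa [Tableau.colOf_smul] using hτ (σ x)
  · intro τ _
    group
  · intro τ _
    group
  · intro τ _
    rw [Tableau.tabloid_smul]
    congr 1
    · simp [smul_smul]
    · rw [Equiv.Perm.sign_mul, Equiv.Perm.sign_mul, Equiv.Perm.sign_inv, mul_comm, ← mul_assoc,
        Int.units_mul_self, one_mul]

/-- The Specht module `S^λ` over `ℚ`: the subrepresentation of `M^λ` spanned by the
`λ`-polytabloids. -/
noncomputable def spechtSub {r : ℕ} (l : PartitionOf r) : Subrepresentation (youngRep l) where
  toSubmodule := Submodule.span ℚ (Set.range (polytabloid (l := l)))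
  apply_mem_toSubmodule σ v hv := by
    induction hv using Submodule.span_induction with
    | mem v hv =>
      obtain ⟨t, rfl⟩ := hv
      rw [youngRep_polytabloid]
      exact Submodule.subset_span ⟨_, rfl⟩
    | zero => rw [map_zero]; exact Submodule.zero_mem _
    | add v w _ _ hv hw => rw [map_add]; exact Submodule.add_mem _ hv hw
    | smul a v _ hv => rw [map_smul]; exact Submodule.smul_mem _ _ hv

/-- The character `χ^λ` of `S_r` afforded by the Specht module `S^λ`. -/
noncomputable def chi {r : ℕ} (l : PartitionOf r) : Equiv.Perm (Fin r) → ℚ :=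
  (spechtSub l).toRepresentation.character

/-! ### Foulkes modules -/

/-- The set partitions of a set of size `mn` into `n` sets each of size `m`. -/
def SetPartition (m n : ℕ) : Type :=
  {P : Finset (Finset (Fin (m * n))) //
    P.card = n ∧ (∀ s ∈ P, s.card = m) ∧ ∀ x, ∃! s, s ∈ P ∧ x ∈ s}

open scoped Pointwise in
/-- The action of `S_{mn}` on these set partitions: `σ • P = {σ(s) : s ∈ P}`. -/
instance setPartitionAction (m n : ℕ) :
    MulAction (Equiv.Perm (Fin (m * n))) (SetPartition m n) where
  smul σ P := ⟨σ • P.1, by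
    obtain ⟨P, h1, h2, h3⟩ := P
    refine ⟨by simpa using h1, ?_, ?_⟩
    · intro s' hs'
      obtain ⟨s, hs, rfl⟩ := Finset.mem_smul_finset.1 hs'
      rw [Finset.card_smul_finset]
      exact h2 s hs
    · intro x
      obtain ⟨s, ⟨hs, hx⟩, hu⟩ := h3 (σ⁻¹ • x)
      refine ⟨σ • s, ⟨Finset.smul_mem_smul_finset hs, ?_⟩, ?_⟩
      · rwa [← Finset.inv_smul_mem_iff]
      · rintro u ⟨hu1, hu2⟩
        obtain ⟨v, hv, rfl⟩ := Finset.mem_smul_finset.1 hu1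
        rw [hu v ⟨hv, Finset.inv_smul_mem_iff.2 hu2⟩]⟩
  one_smul P := Subtype.ext (one_smul _ P.1)
  mul_smul σ τ P := Subtype.ext (mul_smul σ τ P.1)

/-- The Foulkes character `φ^{(m^n)}`: the permutation character of `S_{mn}` on the set partitions
of a set of size `mn` into `n` sets each of size `m`. -/
noncomputable def phi (m n : ℕ) : Equiv.Perm (Fin (m * n)) → ℚ :=
  (Representation.ofMulAction ℚ (Equiv.Perm (Fin (m * n))) (SetPartition m n)).character

/-- The inner product `⟨α, β⟩ = (1 / |G|) ∑_g α(g) β(g⁻¹)` of rational class functions on a finite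
group. -/
noncomputable def charInner {G : Type*} [Group G] [Fintype G] (α β : G → ℚ) : ℚ :=
  (Fintype.card G : ℚ)⁻¹ * ∑ g, α g * β g⁻¹

end Foulkes

namespace Foulkes

open Finset Representation

open scoped Pointwise

/-! ### Inner products of characters -/

/-! Inner products of characters are dimensions of spaces of homomorphisms. A homomorphism from
`S^λ` is determined by the image of one polytabloid `e_t`, and the column stabilizer `C(t)` acts on
that image by the sign. In such an alternating vector of the Foulkes module, the coefficient of a
set partition `P` vanishes as soon as an odd element of `C(t)` fixes `P`. A transposition does so if
a block of `P` has two entries in one column; a product of `m` transpositions does so if two blocks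
meet the same set of columns, and it is odd because `m` is. The surviving `P` therefore give
families of `n` distinct `m`-sets of columns in which column `c` occurs as often as its length
(`IsAlternating.isTransverse`, `IsTransverse.card_filter_colFamily`).

The combinatorial core is `eq_exchangeFamily_and_eq_star`: if `μ` is dominated by `(m^n) ⋆ ν`, such
a family exists only for `μ = (m^n) ⋆ ν`, and it is then the family consisting of `{0, …, m - 1}`
and its one-element exchanges indexed by the boxes of `ν`. This gives the vanishing statement. For
`(m^n) ⋆ ν` itself, all surviving `P` form one orbit of `C(t)`, so alternating vectors are unique up
to scalars and the multiplicity is at most one.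

For the lower bound, the stabilizer of such a `P` in `C(t)` is trivial, so the signed orbit sum of
`P` is nonzero. The submodule it generates shares a constituent with some `S^μ`, because the Specht
characters span the class functions. The nonzero image in `S^μ` of the alternating generator forces
`μ` to be dominated by `(m^n) ⋆ ν`, and the vanishing statement then leaves only `μ = (m^n) ⋆ ν`.
Irreducibility of Specht modules is not needed. -/

theorem charInner_character {G V W : Type*} [Group G] [Fintype G] [AddCommGroup V] [Module ℚ V]
    [FiniteDimensional ℚ V] [AddCommGroup W] [Module ℚ W] [FiniteDimensional ℚ W]
    (ρ : Representation ℚ G V) (σ : Representation ℚ G W) :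
    charInner σ.character ρ.character = Module.finrank ℚ (IntertwiningMap ρ σ) := by
  have : Invertible (Nat.card G : ℚ) :=
    invertibleOfNonzero (Nat.cast_ne_zero.2 Nat.card_pos.ne')
  rw [← card_inv_mul_sum_char_mul_char_eq_finrank ρ σ, charInner, Nat.card_eq_fintype_card]

theorem charInner_comm {G : Type*} [Group G] [Fintype G] (α β : G → ℚ) :
    charInner α β = charInner β α := by
  unfold charInner
  congr 1
  refine Fintype.sum_equiv (Equiv.inv G) _ _ fun g => ?_
  simp [mul_comm]

theorem charInner_character_eq_zero_iff {G V W : Type*} [Group G] [Fintype G] [AddCommGroup V]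
    [Module ℚ V] [FiniteDimensional ℚ V] [AddCommGroup W] [Module ℚ W] [FiniteDimensional ℚ W]
    (ρ : Representation ℚ G V) (σ : Representation ℚ G W) :
    charInner σ.character ρ.character = 0 ↔ ∀ f : IntertwiningMap ρ σ, f = 0 := by
  have : FiniteDimensional ℚ (IntertwiningMap ρ σ) :=
    Module.Finite.of_injective (IntertwiningMap.toLinearMapl ρ σ)
      fun _ _ h => IntertwiningMap.ext h
  rw [charInner_character, Nat.cast_eq_zero, Module.finrank_eq_zero_iff_of_free]
  exact ⟨fun h f => Subsingleton.elim _ _, fun h => ⟨fun f g => (h f).trans (h g).symm⟩⟩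

/-- The inclusion of a subrepresentation. -/
def Subrepresentation.incl {k G V : Type*} [Semiring k] [Monoid G] [AddCommMonoid V] [Module k V]
    {ρ : Representation k G V} (U : Subrepresentation ρ) :
    IntertwiningMap U.toRepresentation ρ where
  toLinearMap := U.toSubmodule.subtype
  isIntertwining' _ := rfl

/-- The subrepresentation generated by a vector. -/
def cyclicSub {k G V : Type*} [CommSemiring k] [Monoid G] [AddCommMonoid V] [Module k V]
    (ρ : Representation k G V) (v : V) : Subrepresentation ρ where
  toSubmodule := Submodule.span k (Set.range fun g => ρ g v)
  apply_mem_toSubmodule g w hw := by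
    induction hw using Submodule.span_induction with
    | mem w hw =>
      obtain ⟨x, rfl⟩ := hw
      exact Submodule.subset_span ⟨g * x, by simp⟩
    | zero => rw [map_zero]; exact Submodule.zero_mem _
    | add v w _ _ hv hw => rw [map_add]; exact Submodule.add_mem _ hv hw
    | smul a v _ hv => rw [map_smul]; exact Submodule.smul_mem _ _ hv

theorem mem_cyclicSub {k G V : Type*} [CommSemiring k] [Monoid G] [AddCommMonoid V] [Module k V]
    (ρ : Representation k G V) (v : V) : v ∈ (cyclicSub ρ v).toSubmodule :=
  Submodule.subset_span ⟨1, by simp⟩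

theorem eq_zero_of_cyclicSub {k G V W : Type*} [CommSemiring k] [Monoid G] [AddCommMonoid V]
    [Module k V] [AddCommMonoid W] [Module k W] {ρ : Representation k G V}
    {σ : Representation k G W} (v : V)
    (f : IntertwiningMap (cyclicSub ρ v).toRepresentation σ)
    (h : f (⟨v, mem_cyclicSub ρ v⟩ : (cyclicSub ρ v).toSubmodule) = 0) : f = 0 := by
  have key : ∀ (w : V) (hw : w ∈ (cyclicSub ρ v).toSubmodule), f (⟨w, hw⟩ : (cyclicSub ρ v).toSubmodule) = 0 := by
    intro w hw
    induction hw using Submodule.span_induction with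
    | mem w hw =>
      obtain ⟨x, rfl⟩ := hw
      have := LinearMap.congr_fun (f.isIntertwining' x)
        (⟨v, mem_cyclicSub ρ v⟩ : (cyclicSub ρ v).toSubmodule)
      exact this.trans ((congrArg (σ x) h).trans (map_zero _))
    | zero => exact map_zero f
    | add v w hv' hw' hv hw =>
      have := map_add f ⟨v, hv'⟩ ⟨w, hw'⟩
      rw [hv, hw, add_zero] at this
      exact this
    | smul a v hv' hv =>
      have := map_smul f a ⟨v, hv'⟩
      rw [hv, smul_zero] at this
      exact this
  ext w
  exact key w.1 w.2

/-! ### Vectors which alternate under a column stabilizer -/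

/-- The column stabilizer of `t` acts on `v` by the sign. -/
def IsAlternating {r : ℕ} {l : PartitionOf r} (t : Tableau l) {V : Type*} [AddCommGroup V]
    [Module ℚ V] (ρ : Representation ℚ (Equiv.Perm (Fin r)) V) (v : V) : Prop :=
  ∀ σ ∈ colStabilizer t, ρ σ v = ((Equiv.Perm.sign σ : ℤ) : ℚ) • v

theorem IsAlternating.map {r : ℕ} {l : PartitionOf r} {t : Tableau l} {V W : Type*}
    [AddCommGroup V] [Module ℚ V] [AddCommGroup W] [Module ℚ W]
    {ρ : Representation ℚ (Equiv.Perm (Fin r)) V} {π : Representation ℚ (Equiv.Perm (Fin r)) W}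
    {v : V} (h : IsAlternating t ρ v) (f : IntertwiningMap ρ π) : IsAlternating t π (f v) := by
  intro σ hσ
  rw [← f.isIntertwining, h σ hσ, map_smul]

theorem mul_mem_colStabilizer {r : ℕ} {l : PartitionOf r} {t : Tableau l}
    {σ τ : Equiv.Perm (Fin r)} (hσ : σ ∈ colStabilizer t) (hτ : τ ∈ colStabilizer t) :
    σ * τ ∈ colStabilizer t := by
  rw [mem_colStabilizer] at *
  intro x
  rw [Equiv.Perm.mul_apply, hσ, hτ]

theorem inv_mem_colStabilizer {r : ℕ} {l : PartitionOf r} {t : Tableau l}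
    {σ : Equiv.Perm (Fin r)} (hσ : σ ∈ colStabilizer t) : σ⁻¹ ∈ colStabilizer t := by
  rw [mem_colStabilizer] at *
  intro x
  rw [← hσ, ← Equiv.Perm.mul_apply, mul_inv_cancel, Equiv.Perm.one_apply]

theorem swap_mem_colStabilizer {r : ℕ} {l : PartitionOf r} {t : Tableau l} {x y : Fin r}
    (h : t.colOf x = t.colOf y) : Equiv.swap x y ∈ colStabilizer t := by
  rw [mem_colStabilizer]
  intro z
  rcases eq_or_ne z x with rfl | hx
  · rw [Equiv.swap_apply_left, h]
  · rcases eq_or_ne z y with rfl | hy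
    · rw [Equiv.swap_apply_right, h]
    · rw [Equiv.swap_apply_of_ne_of_ne hx hy]

/-- The signed sum of the translates of `x` by the column stabilizer of `t`. -/
noncomputable def altSum {r : ℕ} {l : PartitionOf r} (t : Tableau l) {X : Type*}
    [MulAction (Equiv.Perm (Fin r)) X] (x : X) : MonoidAlgebra ℚ X :=
  ∑ τ ∈ colStabilizer t, MonoidAlgebra.single (τ • x) ((Equiv.Perm.sign τ : ℤ) : ℚ)

theorem isAlternating_altSum {r : ℕ} {l : PartitionOf r} (t : Tableau l) {X : Type*}
    [MulAction (Equiv.Perm (Fin r)) X] (x : X) :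
    IsAlternating t (ofMulAction ℚ (Equiv.Perm (Fin r)) X) (altSum t x) := by
  intro σ hσ
  unfold altSum
  rw [map_sum, smul_sum]
  simp only [ofMulAction_single, MonoidAlgebra.smul_single, smul_eq_mul]
  refine sum_bij' (fun τ _ => σ * τ) (fun τ _ => σ⁻¹ * τ) ?_ ?_ ?_ ?_ ?_
  · exact fun τ hτ => mul_mem_colStabilizer hσ hτ
  · exact fun τ hτ => mul_mem_colStabilizer (inv_mem_colStabilizer hσ) hτ
  · simp
  · simp
  · intro τ _
    rw [mul_smul, Equiv.Perm.sign_mul, ← Int.cast_mul, ← Units.val_mul, ← mul_assoc,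
      Int.units_mul_self, one_mul]

theorem IsAlternating.coeff_smul {r : ℕ} {l : PartitionOf r} {t : Tableau l} {X : Type*}
    [MulAction (Equiv.Perm (Fin r)) X] {v : MonoidAlgebra ℚ X}
    (h : IsAlternating t (ofMulAction ℚ (Equiv.Perm (Fin r)) X) v) {σ : Equiv.Perm (Fin r)}
    (hσ : σ ∈ colStabilizer t) (x : X) :
    v.coeff (σ • x) = ((Equiv.Perm.sign σ : ℤ) : ℚ) * v.coeff x := by
  -- The inverse is used because the coefficient of `ρ σ⁻¹ v` at `x` is that of `v` at `σ • x`.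
  have h1 := congrArg (fun w => MonoidAlgebra.coeff w x) (h σ⁻¹ (inv_mem_colStabilizer hσ))
  simpa [coeff_ofMulAction] using h1

theorem IsAlternating.coeff_eq_zero {r : ℕ} {l : PartitionOf r} {t : Tableau l} {X : Type*}
    [MulAction (Equiv.Perm (Fin r)) X] {v : MonoidAlgebra ℚ X}
    (h : IsAlternating t (ofMulAction ℚ (Equiv.Perm (Fin r)) X) v) {σ : Equiv.Perm (Fin r)}
    (hσ : σ ∈ colStabilizer t) {x : X} (hx : σ • x = x) (hs : Equiv.Perm.sign σ = -1) :
    v.coeff x = 0 := by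
  have h1 := h.coeff_smul hσ x
  rw [hx, hs] at h1
  simp only [Units.val_neg, Units.val_one, Int.cast_neg, Int.cast_one, neg_mul, one_mul] at h1
  linarith

/-! ### Homomorphisms from Specht modules -/

theorem Tableau.exists_smul_eq {r : ℕ} {l : PartitionOf r} (t s : Tableau l) :
    ∃ σ : Equiv.Perm (Fin r), σ • t = s :=
  ⟨(Equiv.symm t).trans s, Equiv.ext fun c => congrArg (Equiv.toFun s) (Equiv.symm_apply_apply t c)⟩

instance tableau_nonempty {r : ℕ} (l : PartitionOf r) : Nonempty (Tableau l) :=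
  ⟨Finset.equivFinOfCardEq l.2⟩

instance tableau_finite {r : ℕ} (l : PartitionOf r) : Finite (Tableau l) :=
  inferInstanceAs (Finite ({c // c ∈ l.1.cells} ≃ Fin r))

instance tabloid_finite {r : ℕ} (l : PartitionOf r) : Finite (Tabloid l) :=
  inferInstanceAs (Finite (Quotient (rowSetoid l)))

instance finiteDimensional_monoidAlgebra (X : Type*) [Finite X] :
    FiniteDimensional ℚ (MonoidAlgebra ℚ X) :=
  Module.Finite.equiv (MonoidAlgebra.coeffLinearEquiv (S := ℚ) (M := X) ℚ).symm

/-- The polytabloid of `t` as an element of the Specht module. -/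
noncomputable def spechtGen {r : ℕ} {l : PartitionOf r} (t : Tableau l) :
    (spechtSub l).toSubmodule :=
  ⟨polytabloid t, Submodule.subset_span ⟨t, rfl⟩⟩

theorem spechtGen_smul {r : ℕ} {l : PartitionOf r} (σ : Equiv.Perm (Fin r)) (t : Tableau l) :
    spechtGen (σ • t) = (spechtSub l).toRepresentation σ (spechtGen t) :=
  Subtype.ext (youngRep_polytabloid σ t).symm

theorem isAlternating_spechtGen {r : ℕ} {l : PartitionOf r} (t : Tableau l) :
    IsAlternating t (spechtSub l).toRepresentation (spechtGen t) :=
  fun σ hσ => Subtype.ext (isAlternating_altSum t t.tabloid σ hσ)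

/-- The symmetric group is transitive on tableaux, so a single polytabloid generates the Specht
module. -/
theorem spechtHom_ext {r : ℕ} {l : PartitionOf r} (t : Tableau l) {V : Type*}
    [AddCommGroup V] [Module ℚ V] {ρ : Representation ℚ (Equiv.Perm (Fin r)) V}
    {f g : IntertwiningMap (spechtSub l).toRepresentation ρ}
    (h : f (spechtGen t) = g (spechtGen t)) : f = g := by
  have hs : ∀ s : Tableau l, f (spechtGen s) = g (spechtGen s) := by
    intro s
    obtain ⟨σ, rfl⟩ := t.exists_smul_eq s
    rw [spechtGen_smul, f.isIntertwining, g.isIntertwining, h]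
  have key : ∀ (w : MonoidAlgebra ℚ (Tabloid l)) (hw : w ∈ (spechtSub l).toSubmodule),
      f ⟨w, hw⟩ = g ⟨w, hw⟩ := by
    intro w hw
    induction hw using Submodule.span_induction with
    | mem w hw =>
      obtain ⟨s, rfl⟩ := hw
      exact hs s
    | zero => exact (map_zero f).trans (map_zero g).symm
    | add v w hv' hw' hv hw =>
      have h1 := map_add f ⟨v, hv'⟩ ⟨w, hw'⟩
      rw [hv, hw, ← map_add] at h1
      exact h1
    | smul a v hv' hv =>
      have h1 := map_smul f a ⟨v, hv'⟩
      rw [hv, ← map_smul] at h1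
      exact h1
  ext w
  exact key w.1 w.2

/-! ### The dominance order and alternating vectors in Young permutation modules -/

theorem sum_rowLen_eq_card {r : ℕ} (l : PartitionOf r) (j : ℕ) :
    ∑ i ∈ range j, l.1.rowLen i = (l.1.cells.filter fun c => c.1 < j).card := by
  rw [card_eq_sum_card_fiberwise (f := Prod.fst) (t := range j)
    (fun c hc => by simpa using (mem_filter.1 hc).2)]
  refine sum_congr rfl fun i hi => ?_
  rw [YoungDiagram.rowLen_eq_card, YoungDiagram.row]
  congr 1
  ext c
  simp only [mem_filter, mem_range, YoungDiagram.mem_cells] at hi ⊢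
  constructor
  · rintro ⟨h1, h2⟩
    exact ⟨⟨h1, by omega⟩, h2⟩
  · rintro ⟨⟨h1, -⟩, h2⟩
    exact ⟨h1, h2⟩

theorem card_filter_tableau {r : ℕ} {l : PartitionOf r} (t : Tableau l) (p : ℕ × ℕ → Prop)
    [DecidablePred p] :
    (univ.filter fun x => p (t.rowOf x, t.colOf x)).card = (l.1.cells.filter p).card := by
  refine card_bij (fun x _ => (Equiv.symm t x).1) ?_ ?_ ?_
  · intro x hx
    exact mem_filter.2 ⟨(Equiv.symm t x).2, (mem_filter.1 hx).2⟩
  · intro x _ y _ h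
    exact (Equiv.symm t).injective (Subtype.ext h)
  · intro c hc
    rw [mem_filter] at hc
    refine ⟨Equiv.toFun t ⟨c, hc.1⟩, ?_, ?_⟩
    · have : Equiv.symm t (Equiv.toFun t ⟨c, hc.1⟩) = ⟨c, hc.1⟩ := Equiv.symm_apply_apply t _
      refine mem_filter.2 ⟨mem_univ _, ?_⟩
      rw [Tableau.rowOf, Tableau.colOf, this]
      exact hc.2
    · exact congrArg Subtype.val (Equiv.symm_apply_apply t (⟨c, hc.1⟩ : {c // c ∈ l.1.cells}))

theorem Tableau.ext_entry {r : ℕ} {l : PartitionOf r} (t : Tableau l) {x y : Fin r}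
    (h1 : t.rowOf x = t.rowOf y) (h2 : t.colOf x = t.colOf y) : x = y :=
  (Equiv.symm t).injective (Subtype.ext (Prod.ext h1 h2))

/-- Count column by column of `t`. The first `j` rows of `s` put at most `j` entries, and at most
the column length, into each column of `t`; the first `j` rows of `t` attain the minimum of these
two bounds. -/
theorem dominated_of_rows_transverse {r : ℕ} {l μ : PartitionOf r} (t : Tableau l) (s : Tableau μ)
    (h : ∀ x y, s.rowOf x = s.rowOf y → t.colOf x = t.colOf y → x = y) : Dominated μ l := by
  intro j
  rw [sum_rowLen_eq_card, sum_rowLen_eq_card, ← card_filter_tableau s fun c => c.1 < j,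
    ← card_filter_tableau t fun c => c.1 < j]
  have hmaps : ∀ A : Finset (Fin r), Set.MapsTo t.colOf A (univ.image t.colOf : Finset ℕ) :=
    fun A x _ => by simp
  rw [card_eq_sum_card_fiberwise (hmaps _), card_eq_sum_card_fiberwise (hmaps _)]
  refine sum_le_sum fun c _ => ?_
  have e1 : ((univ.filter fun x => t.rowOf x < j).filter fun x => t.colOf x = c).card =
      min j (l.1.colLen c) := by
    rw [filter_filter, card_filter_tableau t fun d => d.1 < j ∧ d.2 = c]
    rw [← card_range (min j (l.1.colLen c))]
    symm
    refine card_bij (fun i _ => (i, c)) ?_ ?_ ?_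
    · intro i hi
      simp only [mem_range, lt_min_iff] at hi
      simp only [mem_filter, YoungDiagram.mem_cells]
      exact ⟨YoungDiagram.mem_iff_lt_colLen.2 hi.2, hi.1, trivial⟩
    · intro i _ i' _ h
      exact congrArg Prod.fst h
    · rintro ⟨i, c'⟩ hi
      simp only [mem_filter, YoungDiagram.mem_cells] at hi
      obtain ⟨h1, h2, rfl⟩ := hi
      exact ⟨i, by simpa using ⟨h2, YoungDiagram.mem_iff_lt_colLen.1 h1⟩, rfl⟩
  have e1' : (univ.filter fun x => t.colOf x = c).card = l.1.colLen c := by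
    rw [card_filter_tableau t fun d => d.2 = c, YoungDiagram.colLen_eq_card]
    rfl
  rw [e1]
  refine le_min ?_ ?_
  · rw [← card_range j]
    refine card_le_card_of_injOn s.rowOf ?_ ?_
    · intro x hx
      simpa using (mem_filter.1 (mem_filter.1 hx).1).2
    · intro x hx y hy hxy
      exact h x y hxy ((mem_filter.1 hx).2.trans (mem_filter.1 hy).2.symm)
  · rw [← e1']
    refine card_le_card fun x hx => ?_
    simpa using (mem_filter.1 hx).2

/-- At a tabloid `{s}` with nonzero coefficient, no two entries share a row of `s` and a column of
`t`: their transposition would be an odd element of `C(t)` fixing `{s}`. -/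
theorem IsAlternating.dominated {r : ℕ} {l μ : PartitionOf r} {t : Tableau l}
    {v : MonoidAlgebra ℚ (Tabloid μ)} (h : IsAlternating t (youngRep μ) v) (hv : v ≠ 0) :
    Dominated μ l := by
  obtain ⟨q, hq⟩ : ∃ q, v.coeff q ≠ 0 := by
    by_contra! hc
    exact hv (MonoidAlgebra.ext (Finsupp.ext hc))
  induction q using Quotient.inductionOn with
  | h s =>
    refine dominated_of_rows_transverse t s fun x y h1 h2 => ?_
    by_contra hne
    refine hq (IsAlternating.coeff_eq_zero h (swap_mem_colStabilizer h2) ?_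
      (Equiv.Perm.sign_swap hne))
    refine Quotient.sound fun z => ?_
    change (Equiv.swap x y • s).rowOf z = s.rowOf z
    rw [Tableau.rowOf_smul, Equiv.swap_inv]
    rcases eq_or_ne z x with rfl | hx
    · rw [Equiv.swap_apply_left, h1]
    · rcases eq_or_ne z y with rfl | hy
      · rw [Equiv.swap_apply_right, h1]
      · rw [Equiv.swap_apply_of_ne_of_ne hx hy]

theorem Dominated.antisymm {r : ℕ} {l μ : PartitionOf r} (h1 : Dominated μ l)
    (h2 : Dominated l μ) : μ = l := by
  have hs : ∀ j, ∑ i ∈ range j, μ.1.rowLen i = ∑ i ∈ range j, l.1.rowLen i :=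
    fun j => le_antisymm (h1 j) (h2 j)
  have hr : ∀ i, μ.1.rowLen i = l.1.rowLen i := by
    intro i
    have := hs (i + 1)
    rw [sum_range_succ, sum_range_succ, hs i] at this
    omega
  refine Subtype.ext (YoungDiagram.ext ?_)
  ext ⟨i, j⟩
  rw [YoungDiagram.mem_cells, YoungDiagram.mem_cells, YoungDiagram.mem_iff_lt_rowLen,
    YoungDiagram.mem_iff_lt_rowLen, hr]

theorem IsAlternating.dominated_of_specht {r : ℕ} {l μ : PartitionOf r} {t : Tableau l}
    {v : (spechtSub μ).toSubmodule} (h : IsAlternating t (spechtSub μ).toRepresentation v)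
    (hv : v ≠ 0) : Dominated μ l :=
  (h.map (Subrepresentation.incl (spechtSub μ))).dominated fun h0 => hv (Subtype.ext h0)

theorem dominated_of_spechtHom {r : ℕ} {l μ : PartitionOf r}
    (f : IntertwiningMap (spechtSub l).toRepresentation (spechtSub μ).toRepresentation)
    (hf : f ≠ 0) : Dominated μ l := by
  obtain ⟨t⟩ := tableau_nonempty l
  exact ((isAlternating_spechtGen t).map f).dominated_of_specht fun h0 => hf (spechtHom_ext t h0)

/-- The inner product is symmetric, so a nonzero value yields nonzero homomorphisms in both
directions, hence dominance in both directions. -/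
theorem charInner_chi_of_ne {r : ℕ} {l μ : PartitionOf r} (h : l ≠ μ) :
    charInner (chi l) (chi μ) = 0 := by
  by_contra hne
  have h1 := hne
  rw [charInner_comm] at h1
  unfold chi at hne h1
  rw [charInner_character_eq_zero_iff] at hne h1
  push Not at hne h1
  obtain ⟨f, hf⟩ := hne
  obtain ⟨g, hg⟩ := h1
  exact h ((dominated_of_spechtHom f hf).antisymm (dominated_of_spechtHom g hg))

/-- A permutation preserving the rows and the columns of `t` is trivial, so `{t}` keeps the
coefficient `1`. -/
theorem polytabloid_ne_zero {r : ℕ} {l : PartitionOf r} (t : Tableau l) : polytabloid t ≠ 0 := by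
  classical
  intro h
  have h1 := congrArg (fun w => MonoidAlgebra.coeff w t.tabloid) h
  have h2 : ∀ τ ∈ colStabilizer t, τ ≠ 1 →
      (MonoidAlgebra.single (τ • t.tabloid) ((Equiv.Perm.sign τ : ℤ) : ℚ)).coeff t.tabloid = 0 := by
    intro τ hτ hne
    rw [MonoidAlgebra.coeff_single, Finsupp.single_apply, if_neg]
    intro heq
    rw [← Tableau.tabloid_smul] at heq
    have hrow : ∀ x, (τ • t).rowOf x = t.rowOf x := Quotient.exact heq
    rw [mem_colStabilizer] at hτ
    refine hne (Equiv.ext fun x => t.ext_entry ?_ (hτ x))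
    rw [← hrow, Tableau.rowOf_smul, ← Equiv.Perm.mul_apply, inv_mul_cancel, Equiv.Perm.one_apply]
  have h3 : (1 : Equiv.Perm (Fin r)) ∈ colStabilizer t := by simp [mem_colStabilizer]
  simp only [polytabloid, MonoidAlgebra.coeff_sum, Finsupp.finsetSum_apply] at h1
  rw [sum_eq_single_of_mem 1 h3 h2] at h1
  simp at h1

theorem charInner_chi_self {r : ℕ} (l : PartitionOf r) : charInner (chi l) (chi l) ≠ 0 := by
  unfold chi
  rw [Ne, charInner_character_eq_zero_iff]
  intro h
  obtain ⟨t⟩ := tableau_nonempty l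
  refine polytabloid_ne_zero t ?_
  have h1 : (IntertwiningMap.id (spechtSub l).toRepresentation) (spechtGen t) = 0 := by
    rw [h (IntertwiningMap.id _)]; rfl
  exact congrArg Subtype.val h1

/-! ### The characters of the Specht modules span the class functions -/

theorem card_ofRowLens (w : List ℕ) (hw : w.SortedGE) :
    (YoungDiagram.ofRowLens w hw).card = w.sum := by
  have h1 : (YoungDiagram.ofRowLens w hw).card =
      ∑ i ∈ range w.length, ((YoungDiagram.ofRowLens w hw).row i).card := by
    rw [YoungDiagram.card, card_eq_sum_card_fiberwise (f := Prod.fst) (t := range w.length)]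
    · rfl
    · intro c hc
      obtain ⟨h, -⟩ := YoungDiagram.mem_ofRowLens.1 ((YoungDiagram.mem_cells c).1 hc)
      simpa using h
  rw [h1, ← Fin.sum_univ_eq_sum_range (fun i => ((YoungDiagram.ofRowLens w hw).row i).card)]
  simp_rw [← YoungDiagram.rowLen_eq_card]
  calc ∑ i : Fin w.length, (YoungDiagram.ofRowLens w hw).rowLen i
      = ∑ i : Fin w.length, w.get i :=
        sum_congr rfl fun i _ => YoungDiagram.rowLen_ofRowLens i
    _ = w.sum := by rw [← List.sum_ofFn, List.ofFn_get]

/-- The Young diagram of a partition given by the multiset of its parts. -/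
noncomputable def diagramOf {r : ℕ} (p : Nat.Partition r) : PartitionOf r :=
  ⟨YoungDiagram.ofRowLens (p.parts.sort (· ≥ ·)) (p.parts.pairwise_sort (· ≥ ·)).sortedGE, by
    rw [card_ofRowLens, ← Multiset.sum_coe, Multiset.sort_eq, p.parts_sum]⟩

theorem diagramOf_injective (r : ℕ) : Function.Injective (diagramOf (r := r)) := by
  intro p q h
  have h1 := congrArg (fun l : PartitionOf r => l.1.rowLens) h
  simp only [diagramOf] at h1
  rw [YoungDiagram.rowLens_ofRowLens_eq_self, YoungDiagram.rowLens_ofRowLens_eq_self] at h1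
  · ext1
    rw [← Multiset.sort_eq p.parts (· ≥ ·), h1, Multiset.sort_eq]
  · exact fun x hx => q.parts_pos ((Multiset.mem_sort _).1 hx)
  · exact fun x hx => p.parts_pos ((Multiset.mem_sort _).1 hx)

/-- Cycle types provide at least as many Specht characters as there are conjugacy classes; only this
inequality is needed for spanning. -/
theorem exists_injective_conjClasses (r : ℕ) :
    ∃ f : ConjClasses (Equiv.Perm (Fin r)) → PartitionOf r, Function.Injective f := by
  obtain ⟨g, hg⟩ : ∃ g : ConjClasses (Equiv.Perm (Fin r)) → Nat.Partition (Fintype.card (Fin r)),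
      Function.Injective g := by
    refine ⟨Quotient.lift (fun σ => σ.partition)
      fun a b h => Equiv.Perm.partition_eq_of_isConj.1 h, ?_⟩
    intro a b
    induction a using Quotient.inductionOn
    induction b using Quotient.inductionOn
    intro h
    exact Quotient.sound (Equiv.Perm.partition_eq_of_isConj.2 h)
  have h := (diagramOf_injective _).comp hg
  have h' : ∃ f : ConjClasses (Equiv.Perm (Fin r)) → PartitionOf (Fintype.card (Fin r)),
    Function.Injective f := ⟨_, h⟩
  rwa [Fintype.card_fin r] at h'

/-- A class function, as a function on the conjugacy classes. -/
noncomputable def onClasses {G V : Type*} [Group G] [AddCommGroup V] [Module ℚ V] (ρ : Representation ℚ G V) :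
    ConjClasses G → ℚ :=
  Quotient.lift ρ.character fun a b h => by
    obtain ⟨c, rfl⟩ := isConj_iff.1 h
    exact (char_conj ρ a c).symm

/-- The inner product of class functions as a bilinear form. -/
noncomputable def classForm (G : Type*) [Group G] [Fintype G] :
    LinearMap.BilinForm ℚ (ConjClasses G → ℚ) :=
  LinearMap.mk₂ ℚ (fun a b => charInner (fun g => a (ConjClasses.mk g)) fun g =>
      b (ConjClasses.mk g))
    (fun a b c => by simp [charInner, add_mul, sum_add_distrib, mul_add])
    (fun a b c => by
      simp only [charInner, Pi.smul_apply, smul_eq_mul, mul_sum]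
      exact sum_congr rfl fun _ _ => by ring)
    (fun a b c => by simp [charInner, sum_add_distrib, mul_add])
    (fun a b c => by
      simp only [charInner, Pi.smul_apply, smul_eq_mul, mul_sum]
      exact sum_congr rfl fun _ _ => by ring)

theorem classForm_onClasses {G V W : Type*} [Group G] [Fintype G] [AddCommGroup V] [Module ℚ V]
    [AddCommGroup W] [Module ℚ W] (ρ : Representation ℚ G V) (σ : Representation ℚ G W) :
    classForm G (onClasses ρ) (onClasses σ) = charInner ρ.character σ.character := rfl

/-- A nonzero representation of `S_r` has a constituent in common with some Specht module. -/
theorem exists_charInner_chi_ne_zero {r : ℕ} {V : Type*} [AddCommGroup V] [Module ℚ V]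
    [FiniteDimensional ℚ V] (ρ : Representation ℚ (Equiv.Perm (Fin r)) V) [Nontrivial V] :
    ∃ μ : PartitionOf r, charInner ρ.character (chi μ) ≠ 0 := by
  classical
  by_contra! h
  obtain ⟨f, hf⟩ := exists_injective_conjClasses r
  have hli : LinearIndependent ℚ fun c => onClasses (spechtSub (f c)).toRepresentation :=
    LinearMap.BilinForm.linearIndependent_of_iIsOrtho
      (B := classForm (Equiv.Perm (Fin r)))
      (fun a b hab => by
        change classForm _ _ _ = 0
        exact charInner_chi_of_ne fun e => hab (hf e))
      fun a => charInner_chi_self (f a)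
  -- The family is indexed by the conjugacy classes, so it has as many members as the dimension of
  -- the space of class functions.
  have hspan := hli.span_eq_top_of_card_eq_finrank' (by simp)
  have hzero : ∀ b, classForm _ (onClasses ρ) b = 0 := by
    intro b
    have hb : b ∈ Submodule.span ℚ
        (Set.range fun c => onClasses (spechtSub (f c)).toRepresentation) := by
      rw [hspan]; trivial
    induction hb using Submodule.span_induction with
    | mem w hw =>
      obtain ⟨c, rfl⟩ := hw
      exact h (f c)
    | zero => exact map_zero _
    | add v w _ _ hv hw => rw [map_add, hv, hw, add_zero]
    | smul a v _ hv => rw [map_smul, hv, smul_zero]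
  -- Pairing `ρ` with itself shows that its identity map is zero.
  have h0 := hzero (onClasses ρ)
  rw [classForm_onClasses, charInner_character_eq_zero_iff] at h0
  obtain ⟨v, hv⟩ := exists_ne (0 : V)
  have h1 : IntertwiningMap.id ρ v = 0 := by rw [h0 (IntertwiningMap.id ρ)]; rfl
  exact hv h1

/-! ### Sets of boxes with prescribed row and column sums -/

/-- Inclusion–exclusion for the first `p` rows and the first `l` columns. With the bound `p * l` on
the overlap, it turns a lower bound on row sums into an upper bound on column sums; a Young diagram
with an outer corner at `(p, l)` attains equality. -/
theorem card_rows_add_card_cols (D : Finset (ℕ × ℕ)) (p l : ℕ) :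
    (D.filter fun d => d.1 < p).card + (D.filter fun d => d.2 < l).card +
      (D.filter fun d => p ≤ d.1 ∧ l ≤ d.2).card =
      D.card + (D.filter fun d => d.1 < p ∧ d.2 < l).card := by
  simp only [card_filter, card_eq_sum_ones D, ← sum_add_distrib]
  refine sum_congr rfl fun d _ => ?_
  split_ifs <;> omega

theorem card_rectangle_le (D : Finset (ℕ × ℕ)) (p l : ℕ) :
    (D.filter fun d => d.1 < p ∧ d.2 < l).card ≤ p * l := by
  have h : (D.filter fun d => d.1 < p ∧ d.2 < l) ⊆ range p ×ˢ range l := by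
    intro d hd
    simpa using (mem_filter.1 hd).2
  simpa using card_le_card h

theorem YoungDiagram.card_rows_add_card_cols_of_corner (ν : YoungDiagram) {p l : ℕ}
    (h1 : (p, l) ∉ ν) (h2 : ∀ i j, i < p → j < l → (i, j) ∈ ν) :
    (ν.cells.filter fun d => d.1 < p).card + (ν.cells.filter fun d => d.2 < l).card =
      ν.card + p * l := by
  have h3 := card_rows_add_card_cols ν.cells p l
  have h4 : (ν.cells.filter fun d => p ≤ d.1 ∧ l ≤ d.2) = ∅ := by
    refine filter_eq_empty_iff.2 fun d hd h => h1 ?_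
    exact ν.up_left_mem h.1 h.2 ((YoungDiagram.mem_cells d).1 hd)
  have h5 : (ν.cells.filter fun d => d.1 < p ∧ d.2 < l) = range p ×ˢ range l := by
    ext ⟨i, j⟩
    simp only [mem_filter, YoungDiagram.mem_cells, mem_product, mem_range]
    exact ⟨fun h => h.2, fun h => ⟨h2 i j h.1 h.2, h⟩⟩
  rw [h4, h5, card_product, card_range, card_range, card_empty] at h3
  exact h3

/-- A Young diagram is the only set of boxes, among those of its size, whose row and column sums
dominate those of the diagram. -/
theorem eq_cells_of_dominates (ν : YoungDiagram) (D : Finset (ℕ × ℕ)) (hc : D.card = ν.card)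
    (hr : ∀ p, (ν.cells.filter fun d => d.1 < p).card ≤ (D.filter fun d => d.1 < p).card)
    (hl : ∀ l, (ν.cells.filter fun d => d.2 < l).card ≤ (D.filter fun d => d.2 < l).card) :
    D = ν.cells := by
  refine eq_of_subset_of_card_le ?_ hc.ge
  rintro ⟨p, j⟩ hd
  rw [YoungDiagram.mem_cells, YoungDiagram.mem_iff_lt_rowLen]
  by_contra hj
  -- For a box `(p, j)` of `D` outside `ν`, cut at the end of row `p` of `ν`. There `ν` attains
  -- equality, while `D` also has a box beyond the corner, so its row and column sums cannot both be
  -- as large.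
  have h1 := YoungDiagram.card_rows_add_card_cols_of_corner ν (p := p) (l := ν.rowLen p)
    (fun h => lt_irrefl _ (YoungDiagram.mem_iff_lt_rowLen.1 h))
    (fun i j' hi hj' => YoungDiagram.mem_iff_lt_rowLen.2
      (hj'.trans_le (ν.rowLen_anti i p hi.le)))
  have h2 := card_rows_add_card_cols D p (ν.rowLen p)
  have h3 := card_rectangle_le D p (ν.rowLen p)
  have h4 : 0 < (D.filter fun d => p ≤ d.1 ∧ ν.rowLen p ≤ d.2).card :=
    card_pos.2 ⟨(p, j), mem_filter.2 ⟨hd, le_rfl, not_lt.1 hj⟩⟩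
  have h5 := hr p
  have h6 := hl (ν.rowLen p)
  omega

theorem sum_colLen_eq_card (l : YoungDiagram) (k : ℕ) :
    ∑ c ∈ range k, l.colLen c = (l.cells.filter fun c => c.2 < k).card := by
  rw [card_eq_sum_card_fiberwise (f := Prod.snd) (t := range k)
    (fun c hc => by simpa using (mem_filter.1 hc).2)]
  refine sum_congr rfl fun i hi => ?_
  rw [YoungDiagram.colLen_eq_card, YoungDiagram.col]
  congr 1
  ext c
  simp only [mem_filter, mem_range, YoungDiagram.mem_cells] at hi ⊢
  constructor
  · rintro ⟨h1, h2⟩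
    exact ⟨⟨h1, by omega⟩, h2⟩
  · rintro ⟨⟨h1, -⟩, h2⟩
    exact ⟨h1, h2⟩

/-- Conjugation reverses the dominance order. -/
theorem Dominated.sum_colLen_le {r : ℕ} {μ l : PartitionOf r} (h : Dominated μ l) (k : ℕ) :
    ∑ c ∈ range k, l.1.colLen c ≤ ∑ c ∈ range k, μ.1.colLen c := by
  rw [sum_colLen_eq_card, sum_colLen_eq_card]
  -- With `p` the length of column `k` of `μ`, the `p × k` rectangle lies inside `μ` and `(p, k)`
  -- outside, so `μ` attains equality while `l` satisfies only the inequality.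
  have h1 := YoungDiagram.card_rows_add_card_cols_of_corner μ.1 (p := μ.1.colLen k) (l := k)
    (fun h => lt_irrefl _ (YoungDiagram.mem_iff_lt_colLen.1 h))
    (fun i j' hi hj' => YoungDiagram.mem_iff_lt_colLen.2
      (hi.trans_le (μ.1.colLen_anti j' k hj'.le)))
  have h2 := card_rows_add_card_cols l.1.cells (μ.1.colLen k) k
  have h3 := card_rectangle_le l.1.cells (μ.1.colLen k) k
  have h4 := h (μ.1.colLen k)
  rw [sum_rowLen_eq_card, sum_rowLen_eq_card] at h4
  have h5 : l.1.cells.card = r := l.2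
  have h6 : μ.1.card = r := μ.2
  omega

/-! ### Families of sets -/

/-- The set `{0, …, m - 1}` with `m - 1 - d.1` replaced by `m + d.2`. -/
def exchange (m : ℕ) (d : ℕ × ℕ) : Finset ℕ := insert (m + d.2) ((range m).erase (m - 1 - d.1))

/-- The set `{0, …, m - 1}` together with the sets obtained from it by the exchanges in `D`. -/
def exchangeFamily (m : ℕ) (D : Finset (ℕ × ℕ)) : Finset (Finset ℕ) :=
  insert (range m) (D.image (exchange m))

theorem mem_exchange {m : ℕ} {d : ℕ × ℕ} {c : ℕ} :
    c ∈ exchange m d ↔ c = m + d.2 ∨ (c < m ∧ c ≠ m - 1 - d.1) := by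
  simp only [exchange, mem_insert, mem_erase, mem_range]
  tauto

theorem card_exchange {m : ℕ} {d : ℕ × ℕ} (hd : d.1 < m) : (exchange m d).card = m := by
  rw [exchange, card_insert_of_notMem (by simp), card_erase_of_mem (by simp; omega), card_range]
  omega

theorem exchange_ne_range {m : ℕ} {d : ℕ × ℕ} : exchange m d ≠ range m := by
  intro h
  have h1 : m + d.2 ∈ range m := h ▸ mem_exchange.2 (Or.inl rfl)
  simp at h1

theorem exchange_injOn (m : ℕ) : Set.InjOn (exchange m) {d | d.1 < m} := by
  rintro ⟨i, j⟩ hi ⟨i', j'⟩ hi' h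
  simp only [Set.mem_ofPred_eq] at hi hi'
  have h1 : m + j ∈ exchange m (i', j') := h ▸ mem_exchange.2 (Or.inl rfl)
  have h2 : m - 1 - i ∉ exchange m (i', j') := by
    rw [← h, mem_exchange]
    simp only
    omega
  rw [mem_exchange] at h1 h2
  simp only [Prod.mk.injEq] at *
  omega

theorem sum_exchangeFamily {m : ℕ} {D : Finset (ℕ × ℕ)} (hD : ∀ d ∈ D, d.1 < m)
    (f : Finset ℕ → ℕ) :
    ∑ X ∈ exchangeFamily m D, f X = f (range m) + ∑ d ∈ D, f (exchange m d) := by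
  rw [exchangeFamily, sum_insert, sum_image]
  · exact fun a ha b hb h => exchange_injOn m (hD a ha) (hD b hb) h
  · intro h
    obtain ⟨d, -, hd⟩ := mem_image.1 h
    exact exchange_ne_range hd

theorem card_exchangeFamily {m : ℕ} {D : Finset (ℕ × ℕ)} (hD : ∀ d ∈ D, d.1 < m) :
    (exchangeFamily m D).card = D.card + 1 := by
  rw [card_eq_sum_ones, sum_exchangeFamily hD, ← card_eq_sum_ones, add_comm]

theorem card_of_mem_exchangeFamily {m : ℕ} {D : Finset (ℕ × ℕ)} (hD : ∀ d ∈ D, d.1 < m)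
    {X : Finset ℕ} (hX : X ∈ exchangeFamily m D) : X.card = m := by
  rcases mem_insert.1 hX with rfl | hX
  · exact card_range m
  · obtain ⟨d, hd, rfl⟩ := mem_image.1 hX
    exact card_exchange (hD d hd)

/-- The box `(i, j)` trades `m - 1 - i` for `m + j`. So the column sums of `D` count occurrences
from `m` upwards, and its row sums count the missing occurrences below `m`. -/
theorem card_filter_mem_exchangeFamily_of_ge {m : ℕ} {D : Finset (ℕ × ℕ)}
    (hD : ∀ d ∈ D, d.1 < m) (j : ℕ) :
    ((exchangeFamily m D).filter fun X => m + j ∈ X).card =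
      (D.filter fun d => d.2 = j).card := by
  rw [card_filter, sum_exchangeFamily hD, card_filter]
  simp only [mem_range, add_lt_iff_neg_left, not_lt_zero, if_false, zero_add]
  refine sum_congr rfl fun d _ => if_congr ?_ rfl rfl
  rw [mem_exchange]
  omega

theorem card_filter_mem_exchangeFamily_of_lt {m : ℕ} {D : Finset (ℕ × ℕ)}
    (hD : ∀ d ∈ D, d.1 < m) {i : ℕ} (hi : i < m) :
    ((exchangeFamily m D).filter fun X => m - 1 - i ∈ X).card +
      (D.filter fun d => d.1 = i).card = D.card + 1 := by
  rw [card_filter, sum_exchangeFamily hD, card_filter, if_pos (by simp; omega), add_assoc,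
    ← sum_add_distrib, add_comm, card_eq_sum_ones]
  congr 1
  refine sum_congr rfl fun d hd => ?_
  have := hD d hd
  have h : m - 1 - i ∈ exchange m d ↔ ¬ d.1 = i := by
    rw [mem_exchange]
    omega
  simp only [h]
  split_ifs <;> rfl

/-- A threshold at or above `m` detects only the element gained, and one at or below `m` only the
element lost. Thus the first kind reads off column sums of `D` and the second kind row sums. -/
theorem card_exchange_inter_range_of_ge {m : ℕ} {d : ℕ × ℕ} (hd : d.1 < m) (l : ℕ) :
    (exchange m d ∩ range (m + l)).card + 1 = m + if d.2 < l then 1 else 0 := by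
  have h : exchange m d ∩ range (m + l) =
      if d.2 < l then exchange m d else (range m).erase (m - 1 - d.1) := by
    ext c
    split_ifs <;> simp only [mem_inter, mem_exchange, mem_range, mem_erase] <;> omega
  rw [h]
  split_ifs
  · rw [card_exchange hd]
  · rw [card_erase_of_mem (by simp; omega), card_range]
    omega

theorem card_exchange_inter_range_of_le {m : ℕ} {d : ℕ × ℕ} (hd : d.1 < m) {p : ℕ} (hp : p ≤ m) :
    (exchange m d ∩ range (m - p)).card + (if p ≤ d.1 then 1 else 0) = m - p := by
  have h : exchange m d ∩ range (m - p) = (range (m - p)).erase (m - 1 - d.1) := by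
    ext c
    simp only [mem_inter, mem_exchange, mem_range, mem_erase]
    omega
  rw [h]
  split_ifs
  · rw [card_erase_of_mem (by simp; omega), card_range]
    omega
  · rw [erase_eq_of_notMem (by simp; omega), card_range, add_zero]

theorem exists_eq_exchange {m : ℕ} {X : Finset ℕ} (hX : X.card = m)
    (h : (X ∩ range m).card + 1 = m) : ∃ d : ℕ × ℕ, d.1 < m ∧ exchange m d = X := by
  have h1 := card_sdiff_add_card_inter X (range m)
  have h2 := card_sdiff_add_card_inter (range m) X
  rw [inter_comm, card_range] at h2
  obtain ⟨b, hb⟩ := card_eq_one.1 (show (X \ range m).card = 1 by omega)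
  obtain ⟨a, ha⟩ := card_eq_one.1 (show (range m \ X).card = 1 by omega)
  simp only [Finset.ext_iff, mem_sdiff, mem_range, mem_singleton, not_lt] at ha hb
  have hb' := (hb b).2 rfl
  have ha' := (ha a).2 rfl
  refine ⟨(m - 1 - a, b - m), by simp only; omega, ?_⟩
  ext c
  rw [mem_exchange]
  simp only
  have e1 : m + (b - m) = b := by omega
  have e2 : m - 1 - (m - 1 - a) = a := by omega
  rw [e1, e2]
  constructor
  · rintro (rfl | ⟨h3, h4⟩)
    · exact hb'.1
    · by_contra hc
      exact h4 ((ha c).1 ⟨h3, hc⟩)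
  · intro hc
    rcases lt_or_ge c m with h3 | h3
    · refine Or.inr ⟨h3, ?_⟩
      rintro rfl
      exact ha'.2 hc
    · exact Or.inl ((hb c).1 ⟨hc, h3⟩)

/-- The hypothesis says that at most `n - 1` memberships in total lie outside `range m`. Every
`m`-set other than `range m` contributes at least one and the `n` sets are distinct, so `range m`
occurs and every other set contributes exactly one. -/
theorem exists_eq_exchangeFamily {m n : ℕ} {F : Finset (Finset ℕ)} (hF : F.card = n)
    (hm : ∀ X ∈ F, X.card = m) (h : m * n + 1 ≤ (∑ X ∈ F, (X ∩ range m).card) + n) :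
    ∃ D : Finset (ℕ × ℕ), (∀ d ∈ D, d.1 < m) ∧ F = exchangeFamily m D := by
  have hle : ∀ X ∈ F.erase (range m), (X ∩ range m).card + 1 ≤ m := by
    intro X hX
    obtain ⟨h1, h2⟩ := mem_erase.1 hX
    by_contra hlt
    have h3 := hm X h2
    have h4 : X ∩ range m = X := eq_of_subset_of_card_le inter_subset_left (by omega)
    exact h1 (eq_of_subset_of_card_le (inter_eq_left.1 h4) (by rw [card_range, h3]))
  have hmem : range m ∈ F := by
    by_contra hn
    rw [erase_eq_of_notMem hn] at hle
    have h1 := sum_le_sum hle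
    rw [sum_add_distrib, sum_const, sum_const, hF, smul_eq_mul, smul_eq_mul, mul_one,
      mul_comm n m] at h1
    omega
  have hcard : (F.erase (range m)).card + 1 = n := by rw [card_erase_add_one hmem, hF]
  have hsum : ∑ X ∈ F.erase (range m), ((X ∩ range m).card + 1) = ∑ _X ∈ F.erase (range m), m := by
    refine le_antisymm (sum_le_sum hle) ?_
    rw [← add_sum_erase F _ hmem, inter_self, card_range] at h
    rw [sum_add_distrib, sum_const, sum_const, smul_eq_mul, smul_eq_mul, mul_one]
    rw [← hcard] at h
    have e : m * ((F.erase (range m)).card + 1) = (F.erase (range m)).card * m + m := by ring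
    omega
  rw [sum_eq_sum_iff_of_le hle] at hsum
  choose! g hg using fun X hX =>
    exists_eq_exchange (hm X (mem_of_mem_erase hX)) (hsum X hX)
  refine ⟨(F.erase (range m)).image g, ?_, ?_⟩
  · intro d hd
    obtain ⟨X, hX, rfl⟩ := mem_image.1 hd
    exact (hg X hX).1
  · have h1 : ((F.erase (range m)).image g).image (exchange m) = F.erase (range m) := by
      rw [image_image]
      conv_rhs => rw [← image_id (s := F.erase (range m))]
      exact image_congr fun X hX => (hg X hX).2
    rw [exchangeFamily, h1, insert_erase hmem]

/-- Among the families of `n` sets of size `m`, the family given by a partition of `n - 1` is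
determined by the fact that no other family is at least as large in the dominance order. -/
theorem eq_exchangeFamily_of_dominates {m n : ℕ} (hn : 0 < n) (ν : PartitionOf (n - 1))
    (hν : numParts ν ≤ m) {F : Finset (Finset ℕ)} (hF : F.card = n) (hm : ∀ X ∈ F, X.card = m)
    (h : ∀ k, ∑ X ∈ exchangeFamily m ν.1.cells, (X ∩ range k).card ≤
      ∑ X ∈ F, (X ∩ range k).card) :
    F = exchangeFamily m ν.1.cells := by
  have hν' : ∀ d ∈ ν.1.cells, d.1 < m := fun d hd =>
    (bounds_of_mem hn ν hν (i := d.1) (j := d.2) ((YoungDiagram.mem_cells d).1 hd)).1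
  have hνc : ν.1.cells.card + 1 = n := by
    have : ν.1.cells.card = n - 1 := ν.2
    omega
  have sum_ge : ∀ (D : Finset (ℕ × ℕ)), (∀ d ∈ D, d.1 < m) → D.card + 1 = n → ∀ l,
      (∑ X ∈ exchangeFamily m D, (X ∩ range (m + l)).card) + (n - 1) =
        m * n + (D.filter fun d => d.2 < l).card := by
    intro D hD hDc l
    rw [sum_exchangeFamily hD]
    have h1 := sum_congr rfl fun d hd => card_exchange_inter_range_of_ge (hD d hd) l
    rw [sum_add_distrib, sum_add_distrib, ← card_filter, sum_const, sum_const, smul_eq_mul,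
      smul_eq_mul, mul_one] at h1
    have h2 : range m ∩ range (m + l) = range m :=
      inter_eq_left.2 (range_subset_range.2 (Nat.le_add_right _ _))
    rw [h2, card_range, ← hDc, Nat.mul_add, Nat.mul_comm m, Nat.add_sub_cancel]
    omega
  have sum_le : ∀ (D : Finset (ℕ × ℕ)), (∀ d ∈ D, d.1 < m) → D.card + 1 = n → ∀ p ≤ m,
      (∑ X ∈ exchangeFamily m D, (X ∩ range (m - p)).card) + D.card =
        (m - p) * n + (D.filter fun d => d.1 < p).card := by
    intro D hD hDc p hp
    rw [sum_exchangeFamily hD]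
    have h1 := sum_congr rfl fun d hd => card_exchange_inter_range_of_le (hD d hd) hp
    rw [sum_add_distrib, ← card_filter, sum_const, smul_eq_mul] at h1
    have h2 : range m ∩ range (m - p) = range (m - p) :=
      inter_eq_right.2 (range_subset_range.2 (Nat.sub_le _ _))
    have h3 := card_filter_add_card_filter_not (s := D) (fun d => d.1 < p)
    simp only [not_lt] at h3
    rw [h2, card_range, ← hDc, Nat.mul_add, Nat.mul_comm (m - p)]
    omega
  -- The threshold `k = m` alone makes `F` an exchange family; the other thresholds then compare `D`
  -- with `ν`.
  obtain ⟨D, hD, rfl⟩ := exists_eq_exchangeFamily hF hm (by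
    have h1 := h (m + 0)
    have h2 := sum_ge _ hν' hνc 0
    rw [add_zero] at h1 h2
    omega)
  have hDc : D.card + 1 = n := by rw [← hF, card_exchangeFamily hD]
  rw [eq_cells_of_dominates ν.1 D]
  · change D.card = ν.1.cells.card
    omega
  · intro p
    rcases le_total p m with hp | hp
    · have h1 := h (m - p)
      have h2 := sum_le _ hν' hνc p hp
      have h3 := sum_le D hD hDc p hp
      omega
    -- For `p ≥ m` the first `p` rows contain all boxes of both sets, so equality of sizes suffices.
    · rw [filter_true_of_mem fun d hd => (hν' d hd).trans_le hp,
        filter_true_of_mem fun d hd => (hD d hd).trans_le hp]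
      omega
  · intro l
    have h1 := h (m + l)
    have h2 := sum_ge _ hν' hνc l
    have h3 := sum_ge D hD hDc l
    omega

/-- Double counting: partial sums of the column lengths become the threshold counts used for
families. -/
theorem sum_card_filter_mem (F : Finset (Finset ℕ)) (k : ℕ) :
    ∑ c ∈ range k, (F.filter fun X => c ∈ X).card = ∑ X ∈ F, (X ∩ range k).card := by
  simp only [card_filter]
  rw [sum_comm]
  refine sum_congr rfl fun X _ => ?_
  rw [← card_filter, filter_mem_eq_inter, inter_comm]

/-- The columns of `(m^n) ⋆ ν` record the numbers of sets in the family that contain a given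
element. -/
theorem colLen_star {m n : ℕ} (hn : 0 < n) (ν : PartitionOf (n - 1)) (hν : numParts ν ≤ m)
    (c : ℕ) : (star hn ν hν).1.colLen c =
      ((exchangeFamily m ν.1.cells).filter fun X => c ∈ X).card := by
  have hν' : ∀ d ∈ ν.1.cells, d.1 < m ∧ d.2 < n := fun d hd =>
    ⟨(bounds_of_mem hn ν hν (i := d.1) (j := d.2) ((YoungDiagram.mem_cells d).1 hd)).1,
     (bounds_of_mem hn ν hν (i := d.1) (j := d.2) ((YoungDiagram.mem_cells d).1 hd)).2.1⟩
  have hνc : ν.1.cells.card + 1 = n := by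
    have : ν.1.cells.card = n - 1 := ν.2
    omega
  have hcol : (star hn ν hν).1.colLen c =
      ((starCells m n ν.1).filter fun d => d.2 = c).card := by
    rw [YoungDiagram.colLen_eq_card]
    rfl
  rw [hcol]
  rcases lt_or_ge c m with hc | hc
  · have hi : m - 1 - c < m := by omega
    have h1 := card_filter_mem_exchangeFamily_of_lt (fun d hd => (hν' d hd).1) hi
    rw [show m - 1 - (m - 1 - c) = c by omega] at h1
    have h2 : (starCells m n ν.1).filter (fun d => d.2 = c) =
        (range n ×ˢ {c}) \ ((ν.1.cells.filter fun d => d.1 = m - 1 - c).image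
          fun d => (n - 1 - d.2, c)) := by
      ext ⟨a, b⟩
      simp only [starCells, starRemoved, starAdded, mem_filter, mem_union, mem_sdiff, mem_product,
        mem_range, mem_image, mem_singleton, Prod.mk.injEq]
      constructor
      · rintro ⟨⟨⟨h3, h4⟩, h5⟩ | ⟨d, hd, h3, h4⟩, rfl⟩
        · refine ⟨⟨h3, rfl⟩, ?_⟩
          rintro ⟨d, ⟨hd, h6⟩, h7, -⟩
          exact h5 ⟨d, hd, h7, by omega⟩
        · omega
      · rintro ⟨⟨h3, rfl⟩, h4⟩
        refine ⟨Or.inl ⟨⟨h3, hc⟩, ?_⟩, rfl⟩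
        rintro ⟨d, hd, h6, h7⟩
        have := hν' d hd
        exact h4 ⟨d, ⟨hd, by omega⟩, h6, rfl⟩
    have h3 : ((ν.1.cells.filter fun d => d.1 = m - 1 - c).image
          fun d => (n - 1 - d.2, c)).card = (ν.1.cells.filter fun d => d.1 = m - 1 - c).card := by
      refine card_image_of_injOn ?_
      rintro ⟨a, b⟩ ha ⟨a', b'⟩ ha' h
      have ha := mem_filter.1 ha
      have ha' := mem_filter.1 ha'
      have k1 := hν' _ ha.1
      have k2 := hν' _ ha'.1
      simp only [Prod.mk.injEq] at *
      omega
    rw [h2, card_sdiff_of_subset, h3, card_product, card_range, card_singleton]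
    · omega
    · intro x hx
      obtain ⟨d, hd, rfl⟩ := mem_image.1 hx
      simp only [mem_product, mem_range, mem_singleton, and_true]
      omega
  · obtain ⟨j, rfl⟩ := Nat.exists_eq_add_of_le hc
    rw [card_filter_mem_exchangeFamily_of_ge fun d hd => (hν' d hd).1]
    have h2 : (starCells m n ν.1).filter (fun d => d.2 = m + j) =
        (ν.1.cells.filter fun d => d.2 = j).image fun d => (d.1, m + d.2) := by
      ext ⟨a, b⟩
      simp only [starCells, starRemoved, starAdded, mem_filter, mem_union, mem_sdiff, mem_product,
        mem_range, mem_image, Prod.mk.injEq]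
      constructor
      · rintro ⟨⟨⟨h3, h4⟩, h5⟩ | ⟨d, hd, h3, h4⟩, rfl⟩
        · omega
        · exact ⟨d, ⟨hd, by omega⟩, h3, h4⟩
      · rintro ⟨d, ⟨hd, rfl⟩, rfl, rfl⟩
        exact ⟨Or.inr ⟨d, hd, rfl, rfl⟩, rfl⟩
    rw [h2]
    refine card_image_of_injOn ?_
    rintro ⟨a, b⟩ - ⟨a', b'⟩ - h
    simp only [Prod.mk.injEq] at *
    omega

theorem eq_of_colLen_eq {r : ℕ} {μ l : PartitionOf r} (h : ∀ c, μ.1.colLen c = l.1.colLen c) :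
    μ = l := by
  refine Subtype.ext (YoungDiagram.ext ?_)
  ext ⟨i, j⟩
  rw [YoungDiagram.mem_cells, YoungDiagram.mem_cells, YoungDiagram.mem_iff_lt_colLen,
    YoungDiagram.mem_iff_lt_colLen, h]

/-- The only family whose type is the conjugate of a partition dominated by `(m^n) ⋆ ν` is the
one given by `ν`. -/
theorem eq_exchangeFamily_and_eq_star {m n : ℕ} (hn : 0 < n) (ν : PartitionOf (n - 1))
    (hν : numParts ν ≤ m) {μ : PartitionOf (m * n)} (hμ : Dominated μ (star hn ν hν))
    {F : Finset (Finset ℕ)} (hF : F.card = n) (hm : ∀ X ∈ F, X.card = m)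
    (hc : ∀ c, (F.filter fun X => c ∈ X).card = μ.1.colLen c) :
    F = exchangeFamily m ν.1.cells ∧ μ = star hn ν hν := by
  have h := eq_exchangeFamily_of_dominates hn ν hν hF hm fun k => by
    rw [← sum_card_filter_mem, ← sum_card_filter_mem]
    simp only [hc, ← colLen_star hn ν hν]
    exact hμ.sum_colLen_le k
  refine ⟨h, eq_of_colLen_eq fun c => ?_⟩
  rw [← hc, colLen_star, h]

/-! ### Set partitions and the columns of a tableau -/

theorem SetPartition.disjoint_blocks {m n : ℕ} (P : SetPartition m n)
    {s s' : Finset (Fin (m * n))} (hs : s ∈ P.1) (hs' : s' ∈ P.1) {x : Fin (m * n)} (hx : x ∈ s)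
    (hx' : x ∈ s') : s = s' :=
  (P.2.2.2 x).unique ⟨hs, hx⟩ ⟨hs', hx'⟩

theorem SetPartition.smul_eq_of_forall_mem {m n : ℕ} {P Q : SetPartition m n}
    {σ : Equiv.Perm (Fin (m * n))} (h : ∀ s ∈ P.1, σ • s ∈ Q.1) : σ • P = Q := by
  refine Subtype.ext ?_
  change σ • P.1 = Q.1
  refine eq_of_subset_of_card_le ?_ ?_
  · intro s' hs'
    obtain ⟨s, hs, rfl⟩ := mem_smul_finset.1 hs'
    exact h s hs
  · rw [card_smul_finset, P.2.1, Q.2.1]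

theorem SetPartition.smul_mem {m n : ℕ} (P : SetPartition m n) (σ : Equiv.Perm (Fin (m * n)))
    {s : Finset (Fin (m * n))} (hs : s ∈ P.1) : σ • s ∈ (σ • P).1 :=
  smul_mem_smul_finset hs

/-- Each block meets each column at most once, and distinct blocks meet distinct sets of columns. -/
def IsTransverse {m n : ℕ} {l : PartitionOf (m * n)} (t : Tableau l) (P : SetPartition m n) :
    Prop :=
  (∀ s ∈ P.1, Set.InjOn t.colOf s) ∧ Set.InjOn (fun s => s.image t.colOf) (P.1 : Set (Finset _))

/-- The family of the sets of columns met by the blocks. -/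
def colFamily {m n : ℕ} {l : PartitionOf (m * n)} (t : Tableau l) (P : SetPartition m n) :
    Finset (Finset ℕ) :=
  P.1.image fun s => s.image t.colOf

/-- A product of disjoint transpositions. -/
theorem exists_perm_exchanging {α : Type*} [DecidableEq α] [Fintype α] (A : Finset α) (g : α → α)
    (hg : Set.InjOn g A) (hA : ∀ x ∈ A, g x ∉ A) :
    ∃ σ : Equiv.Perm α, (∀ x ∈ A, σ x = g x) ∧ (∀ x ∈ A, σ (g x) = x) ∧
      (∀ z, z ∉ A → (∀ x ∈ A, g x ≠ z) → σ z = z) ∧ Equiv.Perm.sign σ = (-1) ^ A.card := by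
  induction A using Finset.induction_on with
  | empty => exact ⟨1, by simp⟩
  | insert a A ha ih =>
    obtain ⟨σ, h1, h2, h3, h4⟩ := ih (hg.mono (by simp)) fun x hx hx' =>
      hA x (mem_insert_of_mem hx) (mem_insert_of_mem hx')
    have hga : g a ∉ insert a A := hA a (mem_insert_self a A)
    have hne : a ≠ g a := fun h => hga (h ▸ mem_insert_self a A)
    have hgaA : g a ∉ A := fun h => hga (mem_insert_of_mem h)
    have hxa : ∀ x ∈ A, g x ≠ g a := fun x hx h => by
      have := hg (by simp [hx]) (by simp) h
      exact ha (this ▸ hx)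
    have hxa' : ∀ x ∈ A, g x ≠ a := fun x hx h =>
      hA x (mem_insert_of_mem hx) (h ▸ mem_insert_self a A)
    refine ⟨Equiv.swap a (g a) * σ, ?_, ?_, ?_, ?_⟩
    · intro x hx
      rw [Equiv.Perm.mul_apply]
      rcases mem_insert.1 hx with rfl | hx
      · rw [h3 x ha hxa', Equiv.swap_apply_left]
      · rw [h1 x hx, Equiv.swap_apply_of_ne_of_ne (hxa' x hx) (hxa x hx)]
    · intro x hx
      rw [Equiv.Perm.mul_apply]
      rcases mem_insert.1 hx with rfl | hx
      · rw [h3 _ hgaA hxa, Equiv.swap_apply_right]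
      · rw [h2 x hx, Equiv.swap_apply_of_ne_of_ne]
        · exact fun h => ha (h ▸ hx)
        · exact fun h => hgaA (h ▸ hx)
    · intro z hz hz'
      rw [Equiv.Perm.mul_apply, h3 z (fun h => hz (mem_insert_of_mem h))
        fun x hx => hz' x (mem_insert_of_mem hx), Equiv.swap_apply_of_ne_of_ne]
      · rintro rfl; exact hz (mem_insert_self _ _)
      · exact (hz' a (mem_insert_self a A)).symm
    · rw [Equiv.Perm.sign_mul, Equiv.Perm.sign_swap hne, h4, card_insert_of_notMem ha, pow_succ']

theorem IsAlternating.isTransverse {m n : ℕ} (hm : Odd m) {l : PartitionOf (m * n)} {t : Tableau l}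
    {v : MonoidAlgebra ℚ (SetPartition m n)}
    (hv : IsAlternating t (ofMulAction ℚ (Equiv.Perm (Fin (m * n))) (SetPartition m n)) v)
    {P : SetPartition m n} (hP : v.coeff P ≠ 0) : IsTransverse t P := by
  have hinj : ∀ s ∈ P.1, Set.InjOn t.colOf s := by
    intro s hs x hx y hy hxy
    by_contra hne
    refine hP (hv.coeff_eq_zero (swap_mem_colStabilizer hxy) ?_ (Equiv.Perm.sign_swap hne))
    refine SetPartition.smul_eq_of_forall_mem fun s' hs' => ?_
    suffices Equiv.swap x y • s' = s' by rwa [this]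
    refine eq_of_subset_of_card_le ?_ (by rw [card_smul_finset])
    intro z' hz'
    obtain ⟨z, hz, rfl⟩ := mem_smul_finset.1 hz'
    rw [Equiv.Perm.smul_def]
    rcases eq_or_ne z x with rfl | h1
    · rw [Equiv.swap_apply_left, ← P.disjoint_blocks hs hs' hx hz]
      exact hy
    · rcases eq_or_ne z y with rfl | h2
      · rw [Equiv.swap_apply_right, ← P.disjoint_blocks hs hs' hy hz]
        exact hx
      · rwa [Equiv.swap_apply_of_ne_of_ne h1 h2]
  refine ⟨hinj, ?_⟩
  intro s hs s' hs' h
  simp only at h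
  by_contra hne
  have hdisj : ∀ x ∈ s, x ∉ s' := fun x hx hx' => hne (P.disjoint_blocks hs hs' hx hx')
  have hex : ∀ x ∈ s, ∃ y ∈ s', t.colOf y = t.colOf x := fun x hx => by
    have : t.colOf x ∈ s'.image t.colOf := h ▸ mem_image_of_mem _ hx
    exact mem_image.1 this
  choose! g hg1 hg2 using hex
  have hginj : Set.InjOn g s := fun x hx y hy hxy =>
    hinj s hs hx hy (by rw [← hg2 x hx, ← hg2 y hy, hxy])
  -- `g` matches the entries of `s` and `s'` lying in the same column, so `σ` swaps the two blocks,
  -- preserves columns and fixes every other entry.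
  obtain ⟨σ, h1, h2, h3, h4⟩ := exists_perm_exchanging s g hginj
    fun x hx hx' => hdisj _ hx' (hg1 x hx)
  have himg : s.image g = s' := by
    refine eq_of_subset_of_card_le (image_subset_iff.2 hg1) ?_
    rw [card_image_of_injOn hginj, P.2.2.1 s hs, P.2.2.1 s' hs']
  have hfix : ∀ z, z ∉ s → z ∉ s' → σ z = z := fun z hz hz' =>
    h3 z hz fun x hx hxz => hz' (hxz ▸ hg1 x hx)
  have hs'g : ∀ z ∈ s', ∃ x ∈ s, g x = z := fun z hz => mem_image.1 (himg ▸ hz)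
  refine hP (hv.coeff_eq_zero (σ := σ) ?_ ?_ ?_)
  · rw [mem_colStabilizer]
    intro z
    by_cases hz : z ∈ s
    · rw [h1 z hz, hg2 z hz]
    · by_cases hz' : z ∈ s'
      · obtain ⟨x, hx, rfl⟩ := hs'g z hz'
        rw [h2 x hx, hg2 x hx]
      · rw [hfix z hz hz']
  · refine SetPartition.smul_eq_of_forall_mem fun u hu => ?_
    have key : ∀ w ∈ P.1, (∀ z ∈ u, σ z ∈ w) → σ • u ∈ P.1 := by
      intro w hw hsub
      suffices σ • u = w by rwa [this]
      refine eq_of_subset_of_card_le ?_ (by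
        rw [card_smul_finset, P.2.2.1 u hu, P.2.2.1 w hw])
      intro z' hz'
      obtain ⟨z, hz, rfl⟩ := mem_smul_finset.1 hz'
      exact hsub z hz
    by_cases hus : u = s
    · exact key s' hs' fun z hz => by
        rw [h1 z (hus ▸ hz)]; exact hg1 z (hus ▸ hz)
    · by_cases hus' : u = s'
      · refine key s hs fun z hz => ?_
        obtain ⟨x, hx, rfl⟩ := hs'g z (hus' ▸ hz)
        rwa [h2 x hx]
      · refine key u hu fun z hz => ?_
        rwa [hfix z (fun h => hus (P.disjoint_blocks hu hs hz h))
          fun h => hus' (P.disjoint_blocks hu hs' hz h)]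
  -- The parity of `m` enters here: `σ` has sign `(-1) ^ m = -1`.
  · rw [h4, P.2.2.1 s hs, hm.neg_one_pow]

theorem IsTransverse.card_colFamily {m n : ℕ} {l : PartitionOf (m * n)} {t : Tableau l}
    {P : SetPartition m n} (h : IsTransverse t P) : (colFamily t P).card = n := by
  rw [colFamily, card_image_of_injOn h.2, P.2.1]

theorem IsTransverse.card_of_mem_colFamily {m n : ℕ} {l : PartitionOf (m * n)} {t : Tableau l}
    {P : SetPartition m n} (h : IsTransverse t P) {X : Finset ℕ} (hX : X ∈ colFamily t P) :
    X.card = m := by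
  obtain ⟨s, hs, rfl⟩ := mem_image.1 hX
  rw [card_image_of_injOn (h.1 s hs), P.2.2.1 s hs]

theorem card_filter_colOf {r : ℕ} {l : PartitionOf r} (t : Tableau l) (c : ℕ) :
    (univ.filter fun x => t.colOf x = c).card = l.1.colLen c := by
  rw [card_filter_tableau t fun d => d.2 = c, YoungDiagram.colLen_eq_card]
  rfl

/-- Sending an entry of column `c` to its block is a bijection onto the blocks meeting column `c`.
-/
theorem IsTransverse.card_filter_colFamily {m n : ℕ} {l : PartitionOf (m * n)} {t : Tableau l}
    {P : SetPartition m n} (h : IsTransverse t P) (c : ℕ) :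
    ((colFamily t P).filter fun X => c ∈ X).card = l.1.colLen c := by
  choose b hb using fun x => (P.2.2.2 x).exists
  rw [← card_filter_colOf t c, colFamily, filter_image, card_image_of_injOn
    (h.2.mono fun s hs => (mem_filter.1 hs).1)]
  symm
  refine card_bij (fun x _ => b x) ?_ ?_ ?_
  · intro x hx
    refine mem_filter.2 ⟨(hb x).1, mem_image.2 ⟨x, (hb x).2, (mem_filter.1 hx).2⟩⟩
  · intro x hx y hy hxy
    exact h.1 _ (hb x).1 (hb x).2 (hxy ▸ (hb y).2)
      ((mem_filter.1 hx).2.trans (mem_filter.1 hy).2.symm)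
  · intro s hs
    obtain ⟨h1, h2⟩ := mem_filter.1 hs
    obtain ⟨x, hx, hxc⟩ := mem_image.1 h2
    exact ⟨x, by simpa using hxc, P.disjoint_blocks (hb x).1 h1 (hb x).2 hx⟩

/-- Match each block of `P` with the block of `Q` having the same column set, and send each entry to
the entry of the matched block in its own column. -/
theorem IsTransverse.exists_smul_eq {m n : ℕ} {l : PartitionOf (m * n)} {t : Tableau l}
    {P Q : SetPartition m n} (hP : IsTransverse t P) (hQ : IsTransverse t Q)
    (h : colFamily t P = colFamily t Q) : ∃ σ ∈ colStabilizer t, σ • P = Q := by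
  have hex : ∀ x, ∃ y, t.colOf y = t.colOf x ∧ ∀ s ∈ P.1, x ∈ s →
      ∃ s' ∈ Q.1, y ∈ s' ∧ s'.image t.colOf = s.image t.colOf := by
    intro x
    obtain ⟨s, ⟨hs, hx⟩, hu⟩ := P.2.2.2 x
    have h1 : s.image t.colOf ∈ colFamily t Q := h ▸ mem_image_of_mem _ hs
    obtain ⟨s', hs', he⟩ := mem_image.1 h1
    have h2 : t.colOf x ∈ s'.image t.colOf := by
      rw [he]; exact mem_image_of_mem _ hx
    obtain ⟨y, hy, hyx⟩ := mem_image.1 h2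
    refine ⟨y, hyx, fun s₁ hs₁ hx₁ => ⟨s', hs', hy, ?_⟩⟩
    rw [he, hu s₁ ⟨hs₁, hx₁⟩]
  choose f hf1 hf2 using hex
  have hinj : Function.Injective f := by
    intro x y hxy
    obtain ⟨s, hs, hx⟩ := (P.2.2.2 x).exists
    obtain ⟨u, hu, hy⟩ := (P.2.2.2 y).exists
    obtain ⟨s', hs', hxs', h1⟩ := hf2 x s hs hx
    obtain ⟨u', hu', hyu', h2⟩ := hf2 y u hu hy
    have h3 : s' = u' := Q.disjoint_blocks hs' hu' hxs' (hxy ▸ hyu')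
    have h4 : s = u := hP.2 hs hu (by simp only; rw [← h1, ← h2, h3])
    exact hP.1 s hs hx (h4 ▸ hy) (by rw [← hf1 x, ← hf1 y, hxy])
  let σ : Equiv.Perm (Fin (m * n)) :=
    Equiv.ofBijective f (Finite.injective_iff_bijective.1 hinj)
  have hσ : ∀ x, σ x = f x := fun _ => rfl
  refine ⟨σ, (mem_colStabilizer t σ).2 fun x => hf1 x,
    SetPartition.smul_eq_of_forall_mem fun s hs => ?_⟩
  have h1 : s.image t.colOf ∈ colFamily t Q := h ▸ mem_image_of_mem _ hs
  obtain ⟨s', hs', he⟩ := mem_image.1 h1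
  suffices σ • s = s' by rwa [this]
  refine eq_of_subset_of_card_le ?_ (by rw [card_smul_finset, P.2.2.1 s hs, Q.2.2.1 s' hs'])
  intro z hz
  obtain ⟨x, hx, rfl⟩ := mem_smul_finset.1 hz
  obtain ⟨u, hu, hxu, h2⟩ := hf2 x s hs hx
  rw [Equiv.Perm.smul_def, hσ, ← hQ.2 hu hs' (h2.trans he.symm)]
  exact hxu

/-- A column-preserving `σ` preserves the column set of every block. Distinct blocks have distinct
column sets, so `σ` fixes each block, and then each entry, as a block has at most one entry per
column. -/
theorem IsTransverse.eq_one_of_smul_eq {m n : ℕ} {l : PartitionOf (m * n)} {t : Tableau l}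
    {P : SetPartition m n} (hP : IsTransverse t P) {σ : Equiv.Perm (Fin (m * n))}
    (hσ : σ ∈ colStabilizer t) (h : σ • P = P) : σ = 1 := by
  rw [mem_colStabilizer] at hσ
  ext1 x
  obtain ⟨s, hs, hx⟩ := (P.2.2.2 x).exists
  have h1 : σ • s ∈ P.1 := by
    have := P.smul_mem σ hs
    rwa [h] at this
  have h2 : (σ • s).image t.colOf = s.image t.colOf := by
    ext c
    simp only [mem_image, mem_smul_finset, Equiv.Perm.smul_def]
    constructor
    · rintro ⟨_, ⟨y, hy, rfl⟩, rfl⟩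
      exact ⟨y, hy, (hσ y).symm⟩
    · rintro ⟨y, hy, rfl⟩
      exact ⟨_, ⟨y, hy, rfl⟩, hσ y⟩
  have h3 : σ • s = s := hP.2 h1 hs h2
  refine hP.1 s hs ?_ hx (hσ x)
  have h4 : σ x ∈ σ • s := smul_mem_smul_finset hx
  rwa [h3] at h4

theorem altSum_ne_zero {m n : ℕ} {l : PartitionOf (m * n)} {t : Tableau l}
    {P : SetPartition m n} (hP : IsTransverse t P) : altSum t P ≠ 0 := by
  classical
  intro h
  have h1 := congrArg (fun w => MonoidAlgebra.coeff w P) h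
  have h2 : ∀ τ ∈ colStabilizer t, τ ≠ 1 →
      (MonoidAlgebra.single (τ • P) ((Equiv.Perm.sign τ : ℤ) : ℚ)).coeff P = 0 := by
    intro τ hτ hne
    rw [MonoidAlgebra.coeff_single, Finsupp.single_apply, if_neg]
    exact fun heq => hne (hP.eq_one_of_smul_eq hτ heq)
  have h3 : (1 : Equiv.Perm (Fin (m * n))) ∈ colStabilizer t := by simp [mem_colStabilizer]
  simp only [altSum, MonoidAlgebra.coeff_sum, Finsupp.finsetSum_apply] at h1
  rw [sum_eq_single_of_mem 1 h3 h2] at h1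
  simp at h1

/-- Column `c` has as many entries as there are sets in `F` containing `c`. Label its entries
bijectively by these sets; the blocks are the classes of entries with equal label. -/
theorem exists_isTransverse {m n : ℕ} {l : PartitionOf (m * n)} (t : Tableau l)
    {F : Finset (Finset ℕ)} (hF : F.card = n) (hm : ∀ X ∈ F, X.card = m)
    (hc : ∀ c, (F.filter fun X => c ∈ X).card = l.1.colLen c) :
    ∃ P : SetPartition m n, IsTransverse t P := by
  have he : ∀ c, Nonempty ({x // x ∈ univ.filter fun x => t.colOf x = c} ≃
      {X // X ∈ F.filter fun X => c ∈ X}) := fun c =>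
    ⟨Finset.equivOfCardEq (by rw [card_filter_colOf, hc])⟩
  have e := fun c => (he c).some
  let L : Fin (m * n) → Finset ℕ := fun x => (e (t.colOf x) ⟨x, by simp⟩).1
  have hL : ∀ x, L x ∈ F ∧ t.colOf x ∈ L x := fun x =>
    mem_filter.1 (e (t.colOf x) ⟨x, by simp⟩).2
  have hinj : ∀ x y, t.colOf x = t.colOf y → L x = L y → x = y := by
    -- The column is made a variable because the bijections attached to `t.colOf x` and `t.colOf y`
    -- have different types.
    have aux : ∀ c x (hx : t.colOf x = c) y (hy : t.colOf y = c),
        (e c ⟨x, by simpa using hx⟩).1 = (e c ⟨y, by simpa using hy⟩).1 → x = y := by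
      intro c x hx y hy h
      exact congrArg Subtype.val ((e c).injective (Subtype.ext h))
    have aux' : ∀ x c (hx : t.colOf x = c), L x = (e c ⟨x, by simpa using hx⟩).1 := by
      rintro x _ rfl
      rfl
    intro x y hxy h
    exact aux _ x hxy y rfl (by rw [← aux' x _ hxy, h])
  have hsurj : ∀ X ∈ F, ∀ c ∈ X, ∃ x, t.colOf x = c ∧ L x = X := by
    intro X hX c hcX
    obtain ⟨⟨x, hx⟩, h⟩ := (e c).surjective ⟨X, mem_filter.2 ⟨hX, hcX⟩⟩
    have hx' : t.colOf x = c := by simpa using hx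
    subst hx'
    exact ⟨x, rfl, congrArg Subtype.val h⟩
  let B : Finset ℕ → Finset (Fin (m * n)) := fun X => univ.filter fun x => L x = X
  have hB : ∀ x X, x ∈ B X ↔ L x = X := fun x X => by simp [B]
  have himg : ∀ X ∈ F, (B X).image t.colOf = X := by
    intro X hX
    ext c
    rw [mem_image]
    constructor
    · rintro ⟨x, hx, rfl⟩
      exact (hB x X).1 hx ▸ (hL x).2
    · intro hcX
      obtain ⟨x, hx, hx'⟩ := hsurj X hX c hcX
      exact ⟨x, (hB x X).2 hx', hx⟩
  have hinjB : ∀ X, Set.InjOn t.colOf (B X) := fun X x hx y hy h =>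
    hinj x y h (((hB x X).1 hx).trans ((hB y X).1 hy).symm)
  have hBinj : Set.InjOn B F := fun X hX Y hY h => by rw [← himg X hX, h, himg Y hY]
  refine ⟨⟨F.image B, ?_, ?_, ?_⟩, ?_, ?_⟩
  · rw [card_image_of_injOn hBinj, hF]
  · intro s hs
    obtain ⟨X, hX, rfl⟩ := mem_image.1 hs
    rw [← card_image_of_injOn (hinjB X), himg X hX, hm X hX]
  · intro x
    refine ⟨B (L x), ⟨mem_image_of_mem _ (hL x).1, (hB _ _).2 rfl⟩, ?_⟩
    rintro s ⟨hs, hx⟩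
    obtain ⟨X, hX, rfl⟩ := mem_image.1 hs
    rw [(hB x X).1 hx]
  · intro s hs
    obtain ⟨X, hX, rfl⟩ := mem_image.1 hs
    exact hinjB X
  · intro s hs s' hs' h
    obtain ⟨X, hX, rfl⟩ := mem_image.1 hs
    obtain ⟨Y, hY, rfl⟩ := mem_image.1 hs'
    simp only [himg X hX, himg Y hY] at h
    rw [h]

/-! ### Constituents of the Foulkes character -/

instance setPartition_finite (m n : ℕ) : Finite (SetPartition m n) :=
  inferInstanceAs (Finite {P : Finset (Finset (Fin (m * n))) //
    P.card = n ∧ (∀ s ∈ P, s.card = m) ∧ ∀ x, ∃! s, s ∈ P ∧ x ∈ s})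

theorem charInner_phi_eq_zero {m n : ℕ} (hm : Odd m) (hn : 0 < n) (ν : PartitionOf (n - 1))
    (hν : numParts ν ≤ m) {μ : PartitionOf (m * n)} (hμ : StrictlyDominated μ (star hn ν hν)) :
    charInner (phi m n) (chi μ) = 0 := by
  unfold phi chi
  rw [charInner_character_eq_zero_iff]
  intro f
  obtain ⟨t⟩ := tableau_nonempty μ
  refine spechtHom_ext t (MonoidAlgebra.ext (Finsupp.ext fun P => ?_))
  by_contra hP
  have hT := ((isAlternating_spechtGen t).map f).isTransverse hm hP
  exact hμ.2 (eq_exchangeFamily_and_eq_star hn ν hν hμ.1 hT.card_colFamily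
    (fun _ => hT.card_of_mem_colFamily) hT.card_filter_colFamily).2

/-- Both vectors are supported on transverse set partitions. These all have the same column family,
hence form one orbit of `C(t)`, and one coefficient determines the rest. -/
theorem IsAlternating.exists_smul_eq {m n : ℕ} (hm : Odd m) (hn : 0 < n) (ν : PartitionOf (n - 1))
    (hν : numParts ν ≤ m) {t : Tableau (star hn ν hν)}
    {v w : MonoidAlgebra ℚ (SetPartition m n)}
    (hv : IsAlternating t (ofMulAction ℚ (Equiv.Perm (Fin (m * n))) (SetPartition m n)) v)
    (hw : IsAlternating t (ofMulAction ℚ (Equiv.Perm (Fin (m * n))) (SetPartition m n)) w)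
    (h : v ≠ 0) : ∃ a : ℚ, a • v = w := by
  obtain ⟨P, hP⟩ : ∃ P, v.coeff P ≠ 0 := by
    by_contra! hc
    exact h (MonoidAlgebra.ext (Finsupp.ext hc))
  have hfam : ∀ Q, IsTransverse t Q → colFamily t Q = exchangeFamily m ν.1.cells := fun Q hQ =>
    (eq_exchangeFamily_and_eq_star hn ν hν (fun _ => le_rfl) hQ.card_colFamily
      (fun _ => hQ.card_of_mem_colFamily) hQ.card_filter_colFamily).1
  have hTP := hv.isTransverse hm hP
  refine ⟨w.coeff P / v.coeff P, MonoidAlgebra.ext (Finsupp.ext fun Q => ?_)⟩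
  rw [MonoidAlgebra.coeff_smul, Finsupp.smul_apply, smul_eq_mul]
  by_cases hQ : IsTransverse t Q
  · obtain ⟨σ, hσ, rfl⟩ := hTP.exists_smul_eq hQ ((hfam P hTP).trans (hfam Q hQ).symm)
    rw [hv.coeff_smul hσ, hw.coeff_smul hσ]
    field_simp
  · have h1 : v.coeff Q = 0 := by
      by_contra h1
      exact hQ (hv.isTransverse hm h1)
    have h2 : w.coeff Q = 0 := by
      by_contra h2
      exact hQ (hw.isTransverse hm h2)
    rw [h1, h2, mul_zero]

theorem charInner_phi_star_ne_zero {m n : ℕ} (hm : Odd m) (hn : 0 < n) (ν : PartitionOf (n - 1))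
    (hν : numParts ν ≤ m) : charInner (phi m n) (chi (star hn ν hν)) ≠ 0 := by
  obtain ⟨t⟩ := tableau_nonempty (star hn ν hν)
  have hν' : ∀ d ∈ ν.1.cells, d.1 < m := fun d hd =>
    (bounds_of_mem hn ν hν (i := d.1) (j := d.2) ((YoungDiagram.mem_cells d).1 hd)).1
  obtain ⟨P, hP⟩ := exists_isTransverse t (F := exchangeFamily m ν.1.cells)
    (by
      rw [card_exchangeFamily hν']
      have : ν.1.cells.card = n - 1 := ν.2
      omega)
    (fun X => card_of_mem_exchangeFamily hν') (fun c => (colLen_star hn ν hν c).symm)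
  let ρ := ofMulAction ℚ (Equiv.Perm (Fin (m * n))) (SetPartition m n)
  let v := altSum t P
  let U := cyclicSub ρ v
  let u : U.toSubmodule := ⟨v, mem_cyclicSub ρ v⟩
  have hu : IsAlternating t U.toRepresentation u :=
    fun σ hσ => Subtype.ext (isAlternating_altSum t P σ hσ)
  have : Nontrivial U.toSubmodule :=
    ⟨u, 0, fun h => altSum_ne_zero hP (congrArg Subtype.val h)⟩
  obtain ⟨μ, hμ⟩ := exists_charInner_chi_ne_zero U.toRepresentation
  have hμ' := hμ
  rw [charInner_comm] at hμ'
  unfold chi at hμ hμ'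
  rw [Ne, charInner_character_eq_zero_iff] at hμ hμ'
  push Not at hμ hμ'
  obtain ⟨g, hg⟩ := hμ
  obtain ⟨f, hf⟩ := hμ'
  -- The map `f` from `U` to `S^μ` does not kill the generator `u`, whose image alternates under
  -- `C(t)`.
  have hdom : Dominated μ (star hn ν hν) :=
    (hu.map f).dominated_of_specht fun h0 => hf (eq_zero_of_cyclicSub v f h0)
  have hne : charInner (phi m n) (chi μ) ≠ 0 := by
    unfold phi chi
    rw [Ne, charInner_character_eq_zero_iff]
    intro h
    obtain ⟨s⟩ := tableau_nonempty μ
    refine hg (spechtHom_ext s (Subtype.ext ?_))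
    -- The map `g` from `S^μ` to `U`, followed by the inclusion, makes `μ` a constituent of the
    -- Foulkes character.
    have h1 : (Subrepresentation.incl U).comp g = 0 := h _
    exact congrArg (fun k => k (spechtGen s)) h1
  rcases eq_or_ne μ (star hn ν hν) with rfl | hμν
  · exact hne
  · exact absurd (charInner_phi_eq_zero hm hn ν hν ⟨hdom, hμν⟩) hne

theorem charInner_phi_star {m n : ℕ} (hm : Odd m) (hn : 0 < n) (ν : PartitionOf (n - 1))
    (hν : numParts ν ≤ m) : charInner (phi m n) (chi (star hn ν hν)) = 1 := by
  have hne := charInner_phi_star_ne_zero hm hn ν hν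
  unfold phi chi at hne ⊢
  rw [Ne, charInner_character_eq_zero_iff] at hne
  push Not at hne
  obtain ⟨f, hf⟩ := hne
  obtain ⟨t⟩ := tableau_nonempty (star hn ν hν)
  -- It remains to see that every `g` is a multiple of the nonzero `f`, which can be tested on one
  -- polytabloid.
  rw [charInner_character, finrank_eq_one f hf, Nat.cast_one]
  intro g
  obtain ⟨a, ha⟩ := ((isAlternating_spechtGen t).map f).exists_smul_eq hm hn ν hν
    ((isAlternating_spechtGen t).map g) fun h0 => hf (spechtHom_ext t h0)
  exact ⟨a, spechtHom_ext t ha⟩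

end Foulkes

theorem corollary5p2 (m n : ℕ) (hm : Odd m) (hn : 0 < n) (ν : Foulkes.PartitionOf (n - 1))
    (hν : Foulkes.numParts ν ≤ m) :
    Foulkes.charInner (Foulkes.phi m n) (Foulkes.chi (Foulkes.star hn ν hν)) = 1 ∧
      ∀ μ : Foulkes.PartitionOf (m * n),
        Foulkes.StrictlyDominated μ (Foulkes.star hn ν hν) →
          Foulkes.charInner (Foulkes.phi m n) (Foulkes.chi μ) = 0 :=
  ⟨Foulkes.charInner_phi_star hm hn ν hν,
    fun _ hμ => Foulkes.charInner_phi_eq_zero hm hn ν hν hμ⟩
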